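/- Let $N\ge 2$. A convex body in $\mathbb{R}^N$ is a compact convex set with non-empty interior; for a convex body $E$, let $\nu_E\colon\partial E\to\mathbb{S}^{N-1}$ be its inner unit normal, which is defined $\mathscr{H}^{N-1}$-a.e. on $\partial E$. Let $f\colon\mathbb{R}^N\times\mathbb{R}^N\to[0,+\infty]$ be a Borel function with $f\in L^1_{\rm loc}(\mathbb{R}^{2N})$. Assume that there exist a radial Borel function $g\colon\mathbb{R}^N\to[0,+\infty]$ and a lower semicontinuous, positively $1$-homogeneous (i.e. $\Phi(tv)=t\,\Phi(v)$ for all $t>0$ and $v\in\mathbb{R}^N$) and convex function $\Phi\colon\mathbb{R}^N\to[0,+\infty]$ with $\Phi(v)>0$ for all $v\neq 0$, such that $$f(x,v)=g(x)\,\Phi(v)\qquad\text{for all }x,v\in\mathbb{R}^N,$$ where $0\cdot(+\infty)=0$. If the anisotropic weighted perimeter $$P_f(E)=\int_{\partial E}f\big(x,\nu_E(x)\big)\,\mathrm{d}\mathscr{H}^{N-1}(x)$$ satisfies $P_f(A)\le P_f(B)$ for any two convex bodies $A\subset B$ in $\mathbb{R}^N$, then there is a constant $c\in[0,+\infty)$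 such that $g=c$ almost everywhere in $\mathbb{R}^N$ with respect to the Lebesgue measure. -/

import Mathlib

open MeasureTheory Set
open scoped ENNReal NNReal

noncomputable section

namespace WeightedPerimeter

/-- A convex body: a compact convex set with non-empty interior. -/
structure IsConvexBody {N : ℕ} (A : Set (EuclideanSpace ℝ (Fin N))) : Prop where
  isCompact : IsCompact A
  convex : Convex ℝ A
  interior_nonempty : (interior A).Nonempty

/-- `ν` is an inner unit normal of the convex set `A` at `x`: a unit vector such that `A` lies in
the half-space through `x` into which `ν` points. -/
def IsInnerUnitNormal {N : ℕ} (A : Set (EuclideanSpace ℝ (Fin N)))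
    (x ν : EuclideanSpace ℝ (Fin N)) : Prop :=
  ‖ν‖ = 1 ∧ ∀ y ∈ A, 0 ≤ inner ℝ (y - x) ν

open Classical in
/-- The inner unit normal `ν_A(x)` of a convex body `A` at a boundary point `x`. It is the only
inner unit normal at `x` wherever there is exactly one, hence almost everywhere on the boundary for
the `(N-1)`-dimensional Hausdorff measure; at the other points the value is irrelevant and is
set to `0`. -/
def innerUnitNormal {N : ℕ} (A : Set (EuclideanSpace ℝ (Fin N)))
    (x : EuclideanSpace ℝ (Fin N)) : EuclideanSpace ℝ (Fin N) :=
  if h : ∃! ν, IsInnerUnitNormal A x ν then h.choose else 0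

/-- The anisotropic weighted perimeter `∫_{∂A} f(x, ν_A(x)) dH^{N-1}(x)`; `μHE[N - 1]` is the
Hausdorff measure with the Euclidean normalization. -/
def anisotropicPerimeter {N : ℕ} (f : EuclideanSpace ℝ (Fin N) × EuclideanSpace ℝ (Fin N) → ℝ≥0∞)
    (A : Set (EuclideanSpace ℝ (Fin N))) : ℝ≥0∞ :=
  ∫⁻ x in frontier A, f (x, innerUnitNormal A x) ∂μHE[N - 1]

/-- The functional `P` is monotone on nested convex bodies. -/
def MonotoneOnConvexBodies {N : ℕ} (P : Set (EuclideanSpace ℝ (Fin N)) → ℝ≥0∞) : Prop :=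
  ∀ A B : Set (EuclideanSpace ℝ (Fin N)), IsConvexBody A → IsConvexBody B → A ⊆ B → P A ≤ P B

/-- A radial function: its value at a point depends only on the norm of the point. -/
def IsRadial {N : ℕ} (g : EuclideanSpace ℝ (Fin N) → ℝ≥0∞) : Prop :=
  ∀ x y, ‖x‖ = ‖y‖ → g x = g y

/-- Positive `1`-homogeneity, `Φ (t v) = t Φ v` for all `t > 0`. -/
def IsOneHomogeneous {N : ℕ} (Φ : EuclideanSpace ℝ (Fin N) → ℝ≥0∞) : Prop :=
  ∀ (t : ℝ≥0) (v : EuclideanSpace ℝ (Fin N)), 0 < t → Φ ((t : ℝ) • v) = (t : ℝ≥0∞) * Φ v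

end WeightedPerimeter

end

open Filter Topology

/-! Monotonicity is tested on a flat lens and a slightly bulged one. Over a disc of radius δ
orthogonal to a unit vector `n`, the body `lens n p δ η` has a lower boundary independent of `η ≥
0`, while its upper boundary is the graph of `η u` with `u z = (δ² - ‖z‖²) / 2`. The lens for `0`
lies in the lens for `η`, and the common bottom cancels, so only the tops are compared.

Suppose first that the weight is a `C¹` function `G`, and let `Ψ` be the real-valued `Φ`. Where `Ψ`
is differentiable at `-n` with derivative `L` and gradient `l`, the right derivative at `η = 0`
gives `∫ (∂ₙG · u · Ψ(-n) - G · L z) dz ≥ 0` over the disc. Since `∇u = -z` and `u` vanishes on the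
rim, integration by parts moves the derivative onto `G`, and Euler's identity `L (-n) = Ψ (-n)`
merges both terms into `-∫ ∂_l G · u ≥ 0` (`lens_first_variation_eq`). Shrinking the disc yields
`∂_l G ≤ 0` at its centre for every gradient `l` of `Ψ` at a unit vector. Gradients of `Ψ` at points
near `a = ∇G` pair with `a` to nearly `Ψ a`, which is positive unless `a = 0`; hence `∇G = 0`
(`IsGauge.eq_zero_of_forall_fderiv_nonpos`).

The actual `g` is only measurable, so the perimeter inequality is averaged over translations against
a bump function, which replaces `g` by a mollification (`lconv_lens_inequality`). All mollifications
are therefore constant, and so is `g` almost everywhere.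

The area formula is avoided: the area of the bulged top is bounded through a Lipschitz constant, and
the normalization of its normal is dropped. Both errors are of order `η²` and do not affect the
first variation. -/

namespace WeightedPerimeter

/-! ### Finiteness of the two factors -/

section Factors

variable {E : Type*} [NormedAddCommGroup E] [InnerProductSpace ℝ E] [FiniteDimensional ℝ E]
  [MeasurableSpace E] [BorelSpace E]

theorem setLIntegral_mul_ne_top_of_locallyIntegrable {f : E × E → ℝ≥0∞}
    (hf : LocallyIntegrable f volume) {g Φ : E → ℝ≥0∞} (hg : Measurable g) (hΦ : Measurable Φ)
    (hfac : ∀ x v, f (x, v) = g x * Φ v) {K L : Set E} (hK : IsCompact K) (hL : IsCompact L) :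
    (∫⁻ x in K, g x) * ∫⁻ v in L, Φ v ≠ ∞ := by
  have h1 := (hf.integrableOn_isCompact (hK.prod hL)).2
  have h2 : ∫⁻ p in K ×ˢ L, f p = (∫⁻ x in K, g x) * ∫⁻ v in L, Φ v := by
    rw [Measure.volume_eq_prod, ← Measure.prod_restrict,
      ← lintegral_prod_mul hg.aemeasurable hΦ.aemeasurable]
    exact lintegral_congr fun p => hfac p.1 p.2
  rw [← h2]
  simpa [HasFiniteIntegral] using h1.ne

/-- The integral of `Φ` over the unit ball is nonzero because `Φ` is positive off the origin, a null
set in a nontrivial space; an infinite integral of `g` would make the product infinite. -/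
theorem setLIntegral_ne_top_of_mul [Nontrivial E] {f : E × E → ℝ≥0∞}
    (hf : LocallyIntegrable f volume) {g Φ : E → ℝ≥0∞} (hg : Measurable g) (hΦ : Measurable Φ)
    (hΦ_pos : ∀ v, v ≠ 0 → 0 < Φ v) (hfac : ∀ x v, f (x, v) = g x * Φ v)
    {K : Set E} (hK : IsCompact K) : ∫⁻ x in K, g x ≠ ∞ := by
  have h := setLIntegral_mul_ne_top_of_locallyIntegrable hf hg hΦ hfac hK
    (isCompact_closedBall (0 : E) 1)
  intro htop
  rw [htop] at h
  have h0 : ∫⁻ v in Metric.closedBall (0 : E) 1, Φ v = 0 := by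
    by_contra h0
    exact h (ENNReal.top_mul h0)
  rw [lintegral_eq_zero_iff hΦ] at h0
  have h1 : ∀ᵐ v ∂(volume.restrict (Metric.closedBall (0 : E) 1)), v ≠ 0 :=
    ae_restrict_of_ae (Measure.ae_ne volume 0)
  have h2 : ∀ᵐ v ∂(volume.restrict (Metric.closedBall (0 : E) 1)), False := by
    filter_upwards [h0, h1] with v hv hv'
    exact (hΦ_pos v hv').ne' hv
  rw [ae_iff] at h2
  simp only [not_false_eq_true, ofPred_true, Measure.restrict_apply_univ] at h2
  exact (Metric.measure_closedBall_pos volume (0 : E) one_pos).ne' h2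

theorem ae_ne_top_of_setLIntegral_ne_top {g : E → ℝ≥0∞} (hg : Measurable g)
    (hloc : ∀ K : Set E, IsCompact K → ∫⁻ x in K, g x ≠ ∞) :
    ∀ᵐ x ∂(volume : Measure E), g x ≠ ∞ := by
  have key : ∀ k : ℕ, ∀ᵐ x ∂(volume : Measure E), x ∈ Metric.closedBall (0 : E) k → g x ≠ ∞ := by
    intro k
    rw [← ae_restrict_iff' Metric.isClosed_closedBall.measurableSet]
    filter_upwards [ae_lt_top hg (hloc _ (isCompact_closedBall (0 : E) k))] with x hx using hx.ne
  filter_upwards [ae_all_iff.2 key] with x hx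
  obtain ⟨k, hk⟩ := exists_nat_ge ‖x‖
  exact hx k (by simpa using hk)

/-- A ball on which `g` has nonzero integral is needed: with `0 * ∞ = 0`, a null weight would hide
infinite values of `Φ`. -/
theorem ae_ne_top_of_mul {f : E × E → ℝ≥0∞}
    (hf : LocallyIntegrable f volume) {g Φ : E → ℝ≥0∞} (hg : Measurable g) (hΦ : Measurable Φ)
    (hfac : ∀ x v, f (x, v) = g x * Φ v) (hg0 : ¬ ∀ᵐ x ∂(volume : Measure E), g x = 0) :
    ∀ᵐ v ∂(volume : Measure E), Φ v ≠ ∞ := by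
  obtain ⟨k, hk⟩ : ∃ k : ℕ, ∫⁻ x in Metric.closedBall (0 : E) k, g x ≠ 0 := by
    by_contra! h
    apply hg0
    have h1 : ∀ k : ℕ, ∀ᵐ x ∂(volume : Measure E), x ∈ Metric.closedBall (0 : E) k → g x = 0 := by
      intro k
      have := h k
      rw [lintegral_eq_zero_iff hg] at this
      exact (ae_restrict_iff' Metric.isClosed_closedBall.measurableSet).1 this
    filter_upwards [ae_all_iff.2 h1] with x hx
    obtain ⟨k, hk⟩ := exists_nat_ge ‖x‖
    exact hx k (by simpa using hk)
  refine ae_ne_top_of_setLIntegral_ne_top hΦ fun L hL h' => ?_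
  refine setLIntegral_mul_ne_top_of_locallyIntegrable hf hg hΦ hfac
    (isCompact_closedBall (0 : E) k) hL ?_
  rw [h', ENNReal.mul_top hk]

/-- A convex function that is finite almost everywhere is finite everywhere. -/
theorem ne_top_of_convexOn_of_ae {Φ : E → ℝ≥0∞} (hconv : ConvexOn ℝ≥0 univ Φ)
    (hae : ∀ᵐ v ∂(volume : Measure E), Φ v ≠ ∞) (v : E) : Φ v ≠ ∞ := by
  -- `v` is the midpoint of `v + u` and `v - u`, and for almost every `u` both endpoints have finite
  -- value.
  have h1 : ∀ᵐ u ∂(volume : Measure E), Φ (v + u) ≠ ∞ :=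
    (measurePreserving_add_left volume v).quasiMeasurePreserving.ae hae
  have h2 : ∀ᵐ u ∂(volume : Measure E), Φ (v - u) ≠ ∞ :=
    (Measure.measurePreserving_sub_left volume v).quasiMeasurePreserving.ae hae
  obtain ⟨u, hu1, hu2⟩ := (h1.and h2).exists
  have hc := hconv.2
  have h := hc (mem_univ (v + u)) (mem_univ (v - u)) (a := 2⁻¹) (b := 2⁻¹) zero_le
    zero_le (by
      rw [← two_mul]; exact mul_inv_cancel₀ two_ne_zero)
  have h3 : (2⁻¹ : ℝ≥0) • (v + u) + (2⁻¹ : ℝ≥0) • (v - u) = v := by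
    rw [← smul_add, add_add_sub_cancel, ← two_smul ℝ≥0 v, smul_smul,
      inv_mul_cancel₀ two_ne_zero, one_smul]
  rw [h3] at h
  refine ne_top_of_le_ne_top ?_ h
  simp only [ENNReal.smul_def, smul_eq_mul]
  finiteness

end Factors

/-! ### Gauges and their gradients -/

/-- The real-valued form of the hypotheses on the anisotropy: a positive, positively
`1`-homogeneous, subadditive function. -/
structure IsGauge {E : Type*} [NormedAddCommGroup E] [InnerProductSpace ℝ E] (Ψ : E → ℝ) :
    Prop where
  nonneg : ∀ v, 0 ≤ Ψ v
  pos : ∀ v, v ≠ 0 → 0 < Ψ v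
  smul : ∀ t : ℝ, 0 < t → ∀ v, Ψ (t • v) = t * Ψ v
  add_le : ∀ v w, Ψ (v + w) ≤ Ψ v + Ψ w

namespace IsGauge

variable {E : Type*} [NormedAddCommGroup E] [InnerProductSpace ℝ E] {Ψ : E → ℝ}

theorem map_zero (h : IsGauge Ψ) : Ψ 0 = 0 := by
  have := h.smul 2 two_pos 0
  rw [smul_zero] at this
  linarith

theorem convexOn (h : IsGauge Ψ) : ConvexOn ℝ univ Ψ := by
  refine ⟨convex_univ, fun x _ y _ a b ha hb _ => ?_⟩
  have key : ∀ c : ℝ, 0 ≤ c → ∀ z, Ψ (c • z) = c * Ψ z := by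
    intro c hc z
    rcases hc.eq_or_lt with rfl | hc
    · simp [h.map_zero]
    · exact h.smul c hc z
  calc Ψ (a • x + b • y) ≤ Ψ (a • x) + Ψ (b • y) := h.add_le _ _
    _ = a • Ψ x + b • Ψ y := by rw [key a ha, key b hb]; rfl

theorem exists_bound [FiniteDimensional ℝ E] (h : IsGauge Ψ) :
    ∃ M : ℝ≥0, ∀ v, Ψ v ≤ M * ‖v‖ := by
  have hc : Continuous Ψ := by
    rw [← continuousOn_univ]
    exact h.convexOn.continuousOn isOpen_univ
  obtain ⟨M, hM⟩ := (isCompact_sphere (0 : E) 1).bddAbove_image hc.continuousOn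
  refine ⟨M.toNNReal, fun v => ?_⟩
  by_cases hv : v = 0
  · simp [hv, h.map_zero]
  have hv' : 0 < ‖v‖ := norm_pos_iff.2 hv
  have h1 : Ψ (‖v‖⁻¹ • v) ≤ M := hM ⟨_, by simp [norm_smul, hv], rfl⟩
  rw [h.smul _ (inv_pos.2 hv')] at h1
  have h2 : Ψ v ≤ M * ‖v‖ := by
    rwa [inv_mul_le_iff₀ hv', mul_comm] at h1
  exact h2.trans (by gcongr; exact Real.le_coe_toNNReal M)

theorem lipschitzWith (h : IsGauge Ψ) {M : ℝ≥0} (hM : ∀ v, Ψ v ≤ M * ‖v‖) :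
    LipschitzWith M Ψ := by
  refine LipschitzWith.of_le_add_mul M fun x y => ?_
  calc Ψ x = Ψ (y + (x - y)) := by congr 1; abel
    _ ≤ Ψ y + Ψ (x - y) := h.add_le _ _
    _ ≤ Ψ y + M * dist x y := by rw [dist_eq_norm]; gcongr; exact hM _

/-- Euler's identity for a gauge. -/
theorem fderiv_apply_self (h : IsGauge Ψ) {v : E} {L : E →L[ℝ] ℝ} (hLv : HasFDerivAt Ψ L v) :
    L v = Ψ v := by
  have h1 : HasDerivAt (fun t : ℝ => t • v) v 1 := by
    simpa using (hasDerivAt_id (1 : ℝ)).smul_const v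
  have h2 : HasDerivAt (fun t : ℝ => Ψ (t • v)) (L v) 1 := by
    have : HasFDerivAt Ψ L ((1 : ℝ) • v) := by rwa [one_smul]
    exact this.comp_hasDerivAt 1 h1
  have h3 : HasDerivAt (fun t : ℝ => Ψ (t • v)) (Ψ v) 1 := by
    have h4 : HasDerivAt (fun t : ℝ => t * Ψ v) (Ψ v) 1 := by
      simpa using (hasDerivAt_id (1 : ℝ)).mul_const (Ψ v)
    refine h4.congr_of_eventuallyEq ?_
    filter_upwards [lt_mem_nhds (zero_lt_one : (0 : ℝ) < 1)] with t ht using h.smul t ht v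
  exact h2.unique h3

/-- A vector that pairs non-positively with every derivative of a gauge at a unit vector
vanishes. -/
theorem eq_zero_of_forall_fderiv_nonpos [FiniteDimensional ℝ E] (h : IsGauge Ψ) {a : E}
    (ha : ∀ m : E, ‖m‖ = 1 → ∀ L : E →L[ℝ] ℝ, HasFDerivAt Ψ L m → L a ≤ 0) : a = 0 := by
  borelize E
  by_contra ha0
  obtain ⟨M, hM⟩ := h.exists_bound
  have hlip := h.lipschitzWith hM
  have hpos := h.pos a ha0
  -- By Rademacher there is a differentiability point `v` within `r` of `a`. Euler's identity and
  -- the Lipschitz bound give `L a = Ψ v + L (a - v) ≥ Ψ a - 2 M ‖a - v‖`, positive by the second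
  -- entry of the minimum; the first entry forces `v ≠ 0`.
  set r : ℝ := min (‖a‖) (Ψ a / (2 * M + 1)) with hr
  have hden : (0 : ℝ) < 2 * M + 1 := by positivity
  have hr0 : 0 < r := lt_min (norm_pos_iff.2 ha0) (by positivity)
  have hae : ∀ᵐ v ∂(volume : Measure E), DifferentiableAt ℝ Ψ v := hlip.ae_differentiableAt
  obtain ⟨v, hv, hvr⟩ : ∃ v, DifferentiableAt ℝ Ψ v ∧ v ∈ Metric.ball a r := by
    by_contra! hcon
    have : Metric.ball a r ⊆ {v | ¬ DifferentiableAt ℝ Ψ v} := fun v hv hd => hcon v hd hv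
    exact (Metric.measure_ball_pos volume a hr0).ne' (measure_mono_null this hae)
  rw [Metric.mem_ball, dist_eq_norm] at hvr
  have hv0 : v ≠ 0 := by
    rintro rfl
    rw [zero_sub, norm_neg] at hvr
    exact absurd (hvr.trans_le (min_le_left _ _)) (lt_irrefl _)
  have hvn : 0 < ‖v‖ := norm_pos_iff.2 hv0
  set L := fderiv ℝ Ψ v with hL
  have hLv : HasFDerivAt Ψ L v := hv.hasFDerivAt
  -- The derivative of a `1`-homogeneous function is `0`-homogeneous, so `v` may be normalized
  -- without changing `L`.
  have hscale : HasFDerivAt Ψ L (‖v‖⁻¹ • v) := by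
    have h1 : HasFDerivAt (fun x : E => ‖v‖ • x) (‖v‖ • ContinuousLinearMap.id ℝ E)
        (‖v‖⁻¹ • v) := (hasFDerivAt_id _).const_smul ‖v‖
    have h2 : HasFDerivAt Ψ L (‖v‖ • (‖v‖⁻¹ • v)) := by
      rwa [smul_smul, mul_inv_cancel₀ hvn.ne', one_smul]
    have h3 := (h2.comp _ h1).const_smul (‖v‖⁻¹)
    refine (h3.congr_of_eventuallyEq (Eventually.of_forall fun x => ?_)).congr_fderiv ?_
    · simp only [Pi.smul_apply, Function.comp_apply, smul_eq_mul]
      rw [h.smul _ hvn, ← mul_assoc, inv_mul_cancel₀ hvn.ne', one_mul]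
    · ext x
      simp [hvn.ne']
  have hLa := ha (‖v‖⁻¹ • v) (by simp [norm_smul, hv0]) L hscale
  have heuler : L v = Ψ v := h.fderiv_apply_self hLv
  have hLnorm : |L (a - v)| ≤ M * ‖a - v‖ := by
    rw [← Real.norm_eq_abs]
    exact L.le_of_opNorm_le (norm_fderiv_le_of_lipschitz ℝ hlip) _
  have hsplit : L a = L v + L (a - v) := by rw [← map_add]; congr 1; abel
  have hΨ : Ψ a ≤ Ψ v + M * ‖a - v‖ := by
    calc Ψ a = Ψ (v + (a - v)) := by congr 1; abel
      _ ≤ Ψ v + Ψ (a - v) := h.add_le _ _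
      _ ≤ _ := by gcongr; exact hM _
  have hlt : ‖a - v‖ * (2 * M + 1) < Ψ a := by
    rw [← lt_div_iff₀ hden, norm_sub_rev]
    exact hvr.trans_le (min_le_right _ _)
  have := (abs_le.1 hLnorm).1
  nlinarith [norm_nonneg (a - v)]

end IsGauge

theorem isGauge_toReal {N : ℕ} {Φ : EuclideanSpace ℝ (Fin N) → ℝ≥0∞}
    (hΦ_hom : IsOneHomogeneous Φ) (hΦ_convex : ConvexOn ℝ≥0 univ Φ)
    (hΦ_pos : ∀ v, v ≠ 0 → 0 < Φ v) (hfin : ∀ v, Φ v ≠ ∞) :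
    IsGauge fun v => (Φ v).toReal where
  nonneg _ := ENNReal.toReal_nonneg
  pos v hv := ENNReal.toReal_pos (hΦ_pos v hv).ne' (hfin v)
  smul t ht v := by
    have := hΦ_hom ⟨t, ht.le⟩ v ht
    change Φ (t • v) = _ at this
    rw [this, ENNReal.toReal_mul]
    rfl
  add_le v w := by
    have hc := hΦ_convex.2
    -- Midpoint convexity at `2v` and `2w`; homogeneity absorbs the factors and leaves
    -- subadditivity.
    have h := hc (mem_univ ((2 : ℝ≥0) • v)) (mem_univ ((2 : ℝ≥0) • w)) (a := 2⁻¹)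
      (b := 2⁻¹) zero_le zero_le (by rw [← two_mul]; exact mul_inv_cancel₀ two_ne_zero)
    have hs : ∀ z : EuclideanSpace ℝ (Fin N), (2⁻¹ : ℝ≥0) • Φ ((2 : ℝ≥0) • z) = Φ z := by
      intro z
      have := hΦ_hom 2 z two_pos
      rw [← NNReal.smul_def] at this
      rw [this, ENNReal.smul_def, smul_eq_mul, ← mul_assoc, ← ENNReal.coe_mul,
        inv_mul_cancel₀ two_ne_zero, ENNReal.coe_one, one_mul]
    rw [hs, hs, smul_smul, smul_smul, inv_mul_cancel₀ two_ne_zero, one_smul, one_smul] at h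
    rw [← ENNReal.toReal_add (hfin v) (hfin w)]
    exact ENNReal.toReal_mono (ENNReal.add_ne_top.2 ⟨hfin v, hfin w⟩) h

/-- One-sided substitute for the area formula: Hausdorff measure grows by at most `K ^ d`, so the
measure on the image is dominated by a multiple of the pushforward. `F` may be non-measurable, so it
can involve `innerUnitNormal` without a measurability proof. -/
theorem setLIntegral_image_le_of_lipschitzOnWith {X Y : Type*} [EMetricSpace X]
    [MeasurableSpace X] [BorelSpace X] [EMetricSpace Y] [MeasurableSpace Y] [BorelSpace Y]
    {K : ℝ≥0} {Γ : X → Y} {s : Set X} (hΓ : LipschitzOnWith K Γ s) (hΓm : Measurable Γ)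
    (d : ℕ) (F : Y → ℝ≥0∞) :
    ∫⁻ y in Γ '' s, F y ∂μHE[d] ≤ (K : ℝ≥0∞) ^ d * ∫⁻ x in s, F (Γ x) ∂μHE[d] := by
  have hle : (μHE[d] : Measure Y).restrict (Γ '' s) ≤
      ((K : ℝ≥0∞) ^ d) • Measure.map Γ ((μHE[d] : Measure X).restrict s) := by
    refine Measure.le_iff.2 fun T hT => ?_
    rw [Measure.restrict_apply hT, Measure.smul_apply, Measure.map_apply hΓm hT,
      Measure.restrict_apply (hΓm hT), inter_comm T, image_inter_preimage Γ s T |>.symm,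
      inter_comm _ s, smul_eq_mul]
    have := (hΓ.mono (inter_subset_left (s := s) (t := Γ ⁻¹' T))).hausdorffMeasure_image_le
      (d := d) d.cast_nonneg
    rw [ENNReal.rpow_natCast] at this
    simp only [Measure.euclideanHausdorffMeasure_def, Measure.smul_apply, ENNReal.smul_def,
      smul_eq_mul]
    rw [mul_left_comm]
    gcongr
  calc ∫⁻ y in Γ '' s, F y ∂μHE[d]
      ≤ ∫⁻ y, F y ∂(((K : ℝ≥0∞) ^ d) • Measure.map Γ ((μHE[d] : Measure X).restrict s)) :=
        lintegral_mono' hle le_rfl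
    _ = (K : ℝ≥0∞) ^ d * ∫⁻ y, F y ∂(Measure.map Γ ((μHE[d] : Measure X).restrict s)) := by
        rw [lintegral_smul_measure, smul_eq_mul]
    _ ≤ _ := by gcongr; exact lintegral_map_le F Γ

/-! ### Inner unit normals of convex sets -/

section Normal

variable {N : ℕ} {A B : Set (EuclideanSpace ℝ (Fin N))} {x w : EuclideanSpace ℝ (Fin N)}

theorem innerUnitNormal_eq_of_unique {ν : EuclideanSpace ℝ (Fin N)}
    (h : IsInnerUnitNormal A x ν) (huniq : ∀ ν', IsInnerUnitNormal A x ν' → ν' = ν) :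
    innerUnitNormal A x = ν := by
  have hex : ∃! ν, IsInnerUnitNormal A x ν := ⟨ν, h, huniq⟩
  rw [innerUnitNormal, dif_pos hex]
  exact huniq _ hex.choose_spec.1

theorem norm_innerUnitNormal_le : ‖innerUnitNormal A x‖ ≤ 1 := by
  unfold innerUnitNormal
  split_ifs with h
  · exact h.choose_spec.1.1.le
  · simp

/-- `w` is an outer normal, and every direction strictly inside its half-space enters `A`. A second
unit normal `ν` is impossible: with `e = -w/‖w‖`, the direction `e - ν` enters `A` but pairs
negatively with `ν`. -/
theorem innerUnitNormal_eq (hw : w ≠ 0) (h1 : ∀ y ∈ A, inner ℝ (y - x) w ≤ 0)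
    (h2 : ∀ v, inner ℝ v w < 0 → ∃ t : ℝ, 0 < t ∧ x + t • v ∈ A) :
    innerUnitNormal A x = -(‖w‖⁻¹ • w) := by
  have hwn : 0 < ‖w‖ := norm_pos_iff.2 hw
  have hunit : ‖-(‖w‖⁻¹ • w)‖ = 1 := by simp [norm_smul, hwn.ne']
  refine innerUnitNormal_eq_of_unique ⟨hunit, fun y hy => ?_⟩ ?_
  · rw [inner_neg_right, inner_smul_right]
    have := mul_nonpos_of_nonneg_of_nonpos (inv_nonneg.2 hwn.le) (h1 y hy)
    linarith
  · rintro ν ⟨hν, hνA⟩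
    by_contra hne
    set e := -(‖w‖⁻¹ • w) with he
    have hlt : inner ℝ e ν < 1 := by
      refine lt_of_le_of_ne ?_ fun h => hne ?_
      · exact (real_inner_le_norm _ _).trans (by rw [hunit, hν, one_mul])
      · exact ((inner_eq_one_iff_of_norm_eq_one hunit hν).1 h).symm
    have hwe : w = -(‖w‖ • e) := by
      rw [he, smul_neg, neg_neg, smul_smul, mul_inv_cancel₀ hwn.ne', one_smul]
    have hneg : inner ℝ (e - ν) w < 0 := by
      rw [hwe, inner_neg_right, inner_smul_right, inner_sub_left, real_inner_self_eq_norm_sq,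
        hunit, real_inner_comm]
      have : 0 < ‖w‖ * (1 ^ 2 - inner ℝ e ν) := by
        apply mul_pos hwn; linarith
      linarith
    obtain ⟨t, ht, htA⟩ := h2 _ hneg
    have := hνA _ htA
    rw [add_sub_cancel_left, inner_smul_left, inner_sub_left, real_inner_self_eq_norm_sq, hν]
      at this
    have h3 := (mul_nonneg_iff_of_pos_left (by simpa using ht)).1 this
    linarith

/-- Normality is local for convex sets: a short initial piece of the segment from `x` to `y` stays
in `B` and near `x`, and has the direction of `y - x`. -/
theorem IsInnerUnitNormal.of_eventually (hB : Convex ℝ B) (hxB : x ∈ B)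
    (hAB : ∀ᶠ y in 𝓝 x, y ∈ B → y ∈ A) {ν : EuclideanSpace ℝ (Fin N)}
    (h : IsInnerUnitNormal A x ν) : IsInnerUnitNormal B x ν := by
  refine ⟨h.1, fun y hy => ?_⟩
  have ht : Tendsto (fun t : ℝ => x + t • (y - x)) (𝓝[>] 0) (𝓝 x) := by
    have : Continuous fun t : ℝ => x + t • (y - x) := by fun_prop
    have h0 := this.tendsto 0
    simp only [zero_smul, add_zero] at h0
    exact h0.mono_left nhdsWithin_le_nhds
  have hev : ∀ᶠ t : ℝ in 𝓝[>] 0, t ≤ 1 := by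
    filter_upwards [Ioc_mem_nhdsGT (zero_lt_one : (0 : ℝ) < 1)] with t ht using ht.2
  obtain ⟨t, ⟨h1, h2⟩, h3⟩ := ((ht.eventually hAB).and hev |>.and self_mem_nhdsWithin).exists
  have h3 : 0 < t := h3
  have hmem : x + t • (y - x) ∈ B := hB.add_smul_sub_mem hxB hy ⟨h3.le, h2⟩
  have := h.2 _ (h1 hmem)
  rw [add_sub_cancel_left, inner_smul_left] at this
  exact (mul_nonneg_iff_of_pos_left (by simpa using h3)).1 this

theorem innerUnitNormal_congr (hA : Convex ℝ A) (hB : Convex ℝ B) (hxA : x ∈ A) (hxB : x ∈ B)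
    (hAB : ∀ᶠ y in 𝓝 x, y ∈ A ↔ y ∈ B) : innerUnitNormal A x = innerUnitNormal B x := by
  have h : ∀ ν, IsInnerUnitNormal A x ν ↔ IsInnerUnitNormal B x ν := fun ν =>
    ⟨.of_eventually hB hxB (hAB.mono fun _ h => h.2),
      .of_eventually hA hxA (hAB.mono fun _ h => h.1)⟩
  by_cases hu : ∃! ν, IsInnerUnitNormal A x ν
  · obtain ⟨ν, h1, h2⟩ := hu
    rw [innerUnitNormal_eq_of_unique h1 h2,
      innerUnitNormal_eq_of_unique ((h ν).1 h1) fun ν' hν' => h2 ν' ((h ν').2 hν')]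
  · have hu' : ¬ ∃! ν, IsInnerUnitNormal B x ν := by
      simpa only [ExistsUnique, h] using hu
    rw [innerUnitNormal, innerUnitNormal, dif_neg hu, dif_neg hu']

end Normal

/-! ### Geometry of the lens -/

section Lens

variable {E : Type*} [NormedAddCommGroup E] [InnerProductSpace ℝ E]

/-- The component of a vector orthogonal to the unit vector `n`. -/
noncomputable def perp (n : E) : E →L[ℝ] E := ContinuousLinearMap.id ℝ E - (innerSL ℝ n).smulRight n

theorem perp_apply (n v : E) : perp n v = v - inner ℝ n v • n := by
  simp [perp]

/-- The height of `x` over the hyperplane through `p` with normal `n`. -/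
noncomputable def height (n p x : E) : ℝ := inner ℝ n (x - p)

/-- The paraboloid profile `(δ² - ‖x'‖²) / 2`, where `x'` is the component of `x - p` orthogonal
to `n`. -/
noncomputable def profile (n p : E) (δ : ℝ) (x : E) : ℝ := (δ ^ 2 - ‖perp n (x - p)‖ ^ 2) / 2

/-- The convex body between the graphs of the paraboloids `-profile` and `η * profile`. -/
noncomputable def lens (n p : E) (δ η : ℝ) : Set E :=
  {x | -profile n p δ x ≤ height n p x ∧ height n p x ≤ η * profile n p δ x}

/-- The parametrization of the graph of `η * profile` by the hyperplane orthogonal to `n`. -/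
noncomputable def graphMap (n p : E) (δ η : ℝ) (z : (ℝ ∙ n)ᗮ) : E :=
  p + z + (η * ((δ ^ 2 - ‖z‖ ^ 2) / 2)) • n

variable {n p x y : E} {δ η : ℝ}

theorem continuous_height : Continuous (height n p) := by unfold height; fun_prop

theorem continuous_profile : Continuous (profile n p δ) := by unfold profile; fun_prop

theorem continuous_graphMap : Continuous (graphMap n p δ η) := by unfold graphMap; fun_prop

theorem inner_perp (hn : ‖n‖ = 1) (v : E) : inner ℝ n (perp n v) = 0 := by
  rw [perp_apply, inner_sub_right, inner_smul_right, real_inner_self_eq_norm_sq, hn]; ring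

theorem perp_add_smul (v : E) : perp n v + inner ℝ n v • n = v := by
  rw [perp_apply]; abel

theorem norm_perp_sq (hn : ‖n‖ = 1) (v : E) : ‖perp n v‖ ^ 2 + inner ℝ n v ^ 2 = ‖v‖ ^ 2 := by
  conv_rhs => rw [← perp_add_smul (n := n) v]
  rw [norm_add_sq_real, inner_smul_right, real_inner_comm n (perp n v), inner_perp hn,
    norm_smul, hn]
  simp

theorem perp_coe_orthogonal (z : (ℝ ∙ n)ᗮ) : perp n (z : E) = z := by
  rw [perp_apply, Submodule.mem_orthogonal_singleton_iff_inner_right.1 z.2]; simp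

/-- Tangent-plane inequality of a concave function whose gradient at `x` is `-perp n (x - p)`. -/
theorem profile_le (x y : E) :
    profile n p δ y ≤ profile n p δ x - inner ℝ (perp n (x - p)) (perp n (y - x)) := by
  have h : perp n (y - p) = perp n (x - p) + perp n (y - x) := by rw [← map_add]; congr 1; abel
  unfold profile
  rw [h, norm_add_sq_real]
  nlinarith [sq_nonneg ‖perp n (y - x)‖]

theorem profile_add_smul (x v : E) (t : ℝ) : profile n p δ (x + t • v) =
    profile n p δ x - t * inner ℝ (perp n (x - p)) (perp n v) - t ^ 2 * ‖perp n v‖ ^ 2 / 2 := by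
  have h : perp n (x + t • v - p) = perp n (x - p) + t • perp n v := by
    rw [← map_smul, ← map_add]; congr 1; abel
  unfold profile
  rw [h, norm_add_sq_real, inner_smul_right, norm_smul, mul_pow, Real.norm_eq_abs, sq_abs]
  ring

theorem height_add_smul (x v : E) (t : ℝ) :
    height n p (x + t • v) = height n p x + t * inner ℝ n v := by
  unfold height
  rw [add_sub_right_comm, inner_add_right, inner_smul_right]

theorem inner_perp_perp (hn : ‖n‖ = 1) (v w : E) :
    inner ℝ (perp n v) (perp n w) = inner ℝ (perp n v) w := by
  conv_rhs => rw [← perp_add_smul (n := n) w]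
  rw [inner_add_right, inner_smul_right, real_inner_comm n, inner_perp hn]; simp

theorem concaveOn_profile : ConcaveOn ℝ univ (profile n p δ) := by
  refine ⟨convex_univ, fun x _ y _ a b ha hb hab => ?_⟩
  have h : perp n (a • x + b • y - p) = a • perp n (x - p) + b • perp n (y - p) := by
    rw [← map_smul, ← map_smul, ← map_add]
    congr 1
    have : p = (a + b) • p := by rw [hab, one_smul]
    nth_rewrite 1 [this]
    rw [add_smul, smul_sub, smul_sub]; abel
  unfold profile
  rw [h, norm_add_sq_real, norm_smul, norm_smul, inner_smul_left, inner_smul_right,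
    Real.norm_of_nonneg ha, Real.norm_of_nonneg hb, RCLike.conj_to_real, smul_eq_mul, smul_eq_mul]
  have h1 := norm_sub_sq_real (perp n (x - p)) (perp n (y - p))
  have h2 := mul_nonneg (mul_nonneg ha hb) (sq_nonneg ‖perp n (x - p) - perp n (y - p)‖)
  rw [h1] at h2
  obtain rfl : b = 1 - a := by linarith
  nlinarith

theorem convex_lens (hη : 0 ≤ η) : Convex ℝ (lens n p δ η) := by
  have hlin : ∀ x y : E, ∀ a b : ℝ, a + b = 1 →
      height n p (a • x + b • y) = a * height n p x + b * height n p y := by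
    intro x y a b hab
    unfold height
    rw [← inner_smul_right, ← inner_smul_right, ← inner_add_right]
    congr 1
    have : p = (a + b) • p := by rw [hab, one_smul]
    nth_rewrite 1 [this]
    rw [add_smul, smul_sub, smul_sub]; abel
  intro x hx y hy a b ha hb hab
  have hc := concaveOn_profile (n := n) (p := p) (δ := δ)
  have hq := hc.2 (mem_univ x) (mem_univ y) ha hb hab
  simp only [smul_eq_mul] at hq
  refine ⟨?_, ?_⟩
  · rw [hlin x y a b hab]
    nlinarith [mul_le_mul_of_nonneg_left hx.1 ha, mul_le_mul_of_nonneg_left hy.1 hb]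
  · rw [hlin x y a b hab]
    nlinarith [mul_le_mul_of_nonneg_left hx.2 ha, mul_le_mul_of_nonneg_left hy.2 hb,
      mul_le_mul_of_nonneg_left hq hη]

theorem profile_nonneg_of_mem_lens (hη : 0 ≤ η) (hx : x ∈ lens n p δ η) :
    0 ≤ profile n p δ x := by
  have h : -profile n p δ x ≤ η * profile n p δ x := hx.1.trans hx.2
  nlinarith

theorem isClosed_lens : IsClosed (lens n p δ η) :=
  (isClosed_le continuous_profile.neg continuous_height).inter
    (isClosed_le continuous_height (continuous_const.mul continuous_profile))

theorem profile_le_half_sq : profile n p δ x ≤ δ ^ 2 / 2 := by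
  unfold profile
  nlinarith [sq_nonneg ‖perp n (x - p)‖]

theorem isCompact_lens [FiniteDimensional ℝ E] (hn : ‖n‖ = 1) (hη : 0 ≤ η) :
    IsCompact (lens n p δ η) := by
  refine Metric.isCompact_of_isClosed_isBounded isClosed_lens ?_
  refine (Metric.isBounded_iff_subset_closedBall p).2
    ⟨√(δ ^ 2 + ((1 + η) * (δ ^ 2 / 2)) ^ 2), fun x hx => ?_⟩
  rw [Metric.mem_closedBall, dist_eq_norm]
  apply Real.le_sqrt_of_sq_le
  have h0 := profile_nonneg_of_mem_lens hη hx
  have h1 := profile_le_half_sq (n := n) (p := p) (δ := δ) (x := x)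
  rw [← norm_perp_sq hn]
  have h2 : ‖perp n (x - p)‖ ^ 2 ≤ δ ^ 2 := by unfold profile at h0; linarith
  have h3 : inner ℝ n (x - p) ^ 2 ≤ ((1 + η) * (δ ^ 2 / 2)) ^ 2 := by
    have h4 : -profile n p δ x ≤ inner ℝ n (x - p) := hx.1
    have h5 : inner ℝ n (x - p) ≤ η * profile n p δ x := hx.2
    have h6 := mul_le_mul_of_nonneg_left h1 hη
    apply sq_le_sq'
    · nlinarith
    · nlinarith
  linarith

theorem mem_interior_lens (h1 : -profile n p δ x < height n p x)
    (h2 : height n p x < η * profile n p δ x) : x ∈ interior (lens n p δ η) := by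
  refine mem_interior_iff_mem_nhds.2 ?_
  filter_upwards [(continuous_profile.neg.tendsto x).eventually_lt (continuous_height.tendsto x) h1,
    (continuous_height.tendsto x).eventually_lt
      ((continuous_const.mul continuous_profile).tendsto x) h2] with y hy1 hy2
  exact ⟨hy1.le, hy2.le⟩

theorem interior_lens_nonempty (hn : ‖n‖ = 1) (hδ : 0 < δ) (hη : 0 ≤ η) :
    (interior (lens n p δ η)).Nonempty := by
  -- Below `p` the lens reaches depth `δ² / 2`; this is the midpoint of that segment, interior even
  -- when `η = 0`.
  refine ⟨p + (-(δ ^ 2 / 4)) • n, ?_⟩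
  have hpn : perp n n = 0 := by
    rw [perp_apply, real_inner_self_eq_norm_sq, hn]; simp
  have hh : height n p (p + (-(δ ^ 2 / 4)) • n) = -(δ ^ 2 / 4) := by
    unfold height
    rw [add_sub_cancel_left, inner_smul_right, real_inner_self_eq_norm_sq, hn]; ring
  have hp : profile n p δ (p + (-(δ ^ 2 / 4)) • n) = δ ^ 2 / 2 := by
    unfold profile
    rw [add_sub_cancel_left, map_smul, hpn]; simp
  have := sq_pos_of_pos hδ
  apply mem_interior_lens
  · rw [hh, hp]; linarith
  · rw [hh, hp]; nlinarith [mul_nonneg hη this.le]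

/-- The lower part of the boundary, common to all lenses. -/
noncomputable def lensBottom (n p : E) (δ : ℝ) : Set E :=
  {x | height n p x = -profile n p δ x ∧ 0 < profile n p δ x}

/-- The open upper part of the boundary. -/
noncomputable def lensTop (n p : E) (δ η : ℝ) : Set E :=
  {x | height n p x = η * profile n p δ x ∧ 0 < profile n p δ x}

theorem lensBottom_subset (hη : 0 ≤ η) : lensBottom n p δ ⊆ lens n p δ η := fun x hx => by
  refine ⟨hx.1.ge, ?_⟩
  rw [hx.1]
  nlinarith [hx.2, mul_nonneg hη hx.2.le]

theorem lensTop_subset (hη : 0 ≤ η) : lensTop n p δ η ⊆ lens n p δ η := fun x hx => by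
  refine ⟨?_, hx.1.le⟩
  rw [hx.1]
  nlinarith [hx.2, mul_nonneg hη hx.2.le]

theorem disjoint_lensBottom_lensTop (hη : 0 ≤ η) :
    Disjoint (lensBottom n p δ) (lensTop n p δ η) := by
  refine Set.disjoint_left.2 fun x h1 h2 => ?_
  have := h1.1.symm.trans h2.1
  nlinarith [h1.2, mul_nonneg hη h1.2.le]

/-- The vector `n + η • perp n (x - p)` is the gradient of `height - η * profile`. Along `v` this
function decreases to first order and the quadratic remainder is negligible for small `t`; the lower
constraint is strict at `x`. -/
theorem exists_add_smul_mem_lens (hn : ‖n‖ = 1) (hη : 0 ≤ η) (hx : x ∈ lensTop n p δ η) {v : E}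
    (hv : inner ℝ v (n + η • perp n (x - p)) < 0) :
    ∃ t : ℝ, 0 < t ∧ x + t • v ∈ lens n p δ η := by
  have hv' : inner ℝ n v + η * inner ℝ (perp n (x - p)) (perp n v) < 0 := by
    rw [inner_perp_perp hn]
    rw [inner_add_right, inner_smul_right, real_inner_comm, real_inner_comm (perp n (x - p))] at hv
    exact hv
  have hcont : Continuous fun t : ℝ => x + t • v := by fun_prop
  have h0 := (hcont.tendsto 0).mono_left (nhdsWithin_le_nhds (s := Ioi 0))
  simp only [zero_smul, add_zero] at h0
  have hlow : ∀ᶠ y in 𝓝 x, -profile n p δ y < height n p y := by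
    apply (continuous_profile.neg.tendsto x).eventually_lt (continuous_height.tendsto x)
    rw [hx.1]
    change -profile n p δ x < _
    nlinarith [hx.2, mul_nonneg hη hx.2.le]
  have hc2 : Tendsto (fun t : ℝ => inner ℝ n v + η * inner ℝ (perp n (x - p)) (perp n v) +
      η * (t * ‖perp n v‖ ^ 2 / 2)) (𝓝[>] 0)
      (𝓝 (inner ℝ n v + η * inner ℝ (perp n (x - p)) (perp n v))) := by
    have : Continuous fun t : ℝ => inner ℝ n v + η * inner ℝ (perp n (x - p)) (perp n v) +
      η * (t * ‖perp n v‖ ^ 2 / 2) := by fun_prop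
    have := (this.tendsto 0).mono_left (nhdsWithin_le_nhds (s := Ioi 0))
    simpa using this
  obtain ⟨t, ⟨ht1, ht2⟩, ht0⟩ := ((h0.eventually hlow).and
    (hc2.eventually_lt_const hv') |>.and self_mem_nhdsWithin).exists
  have ht0 : 0 < t := ht0
  refine ⟨t, ht0, ht1.le, ?_⟩
  rw [height_add_smul, profile_add_smul, hx.1]
  nlinarith [mul_neg_of_pos_of_neg ht0 ht2]

theorem inner_sub_nonpos_of_mem_lens (hn : ‖n‖ = 1) (hη : 0 ≤ η) (hx : x ∈ lensTop n p δ η)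
    (hy : y ∈ lens n p δ η) : inner ℝ (y - x) (n + η • perp n (x - p)) ≤ 0 := by
  rw [inner_add_right, inner_smul_right, real_inner_comm, real_inner_comm (perp n (x - p)),
    ← inner_perp_perp hn]
  have h1 := mul_le_mul_of_nonneg_left (profile_le (n := n) (p := p) (δ := δ) x y) hη
  have h2 : inner ℝ n (y - x) = height n p y - height n p x := by
    unfold height; rw [← inner_sub_right]; congr 1; abel
  rw [h2, hx.1]
  nlinarith [hy.2]

theorem one_le_norm_add_smul_perp (hn : ‖n‖ = 1) (v : E) : 1 ≤ ‖n + η • perp n v‖ := by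
  have h : ‖n + η • perp n v‖ ^ 2 = 1 + (η * ‖perp n v‖) ^ 2 := by
    rw [norm_add_sq_real, inner_smul_right, inner_perp hn, norm_smul, hn, mul_pow,
      Real.norm_eq_abs, sq_abs]
    ring
  nlinarith [norm_nonneg (n + η • perp n v), sq_nonneg (η * ‖perp n v‖)]

theorem lensTop_subset_frontier (hn : ‖n‖ = 1) (hη : 0 ≤ η) :
    lensTop n p δ η ⊆ frontier (lens n p δ η) := by
  intro x hx
  rw [isClosed_lens.frontier_eq]
  refine ⟨lensTop_subset hη hx, fun h_int => ?_⟩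
  have hcont : Continuous fun t : ℝ => x + t • n := by fun_prop
  have h0 := (hcont.tendsto 0).mono_left (nhdsWithin_le_nhds (s := Ioi 0))
  simp only [zero_smul, add_zero] at h0
  obtain ⟨t, ht, ht0⟩ := ((h0.eventually (mem_interior_iff_mem_nhds.1 h_int)).and
    self_mem_nhdsWithin).exists
  have ht0 : 0 < t := ht0
  have := inner_sub_nonpos_of_mem_lens hn hη hx ht
  rw [add_sub_cancel_left, inner_smul_left, inner_add_right, inner_smul_right, inner_perp hn,
    real_inner_self_eq_norm_sq, hn] at this
  simp at this
  linarith

theorem lensBottom_subset_frontier (hn : ‖n‖ = 1) (hη : 0 ≤ η) :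
    lensBottom n p δ ⊆ frontier (lens n p δ η) := by
  intro x hx
  rw [isClosed_lens.frontier_eq]
  refine ⟨lensBottom_subset hη hx, fun h_int => ?_⟩
  have hcont : Continuous fun t : ℝ => x + t • (-n) := by fun_prop
  have h0 := (hcont.tendsto 0).mono_left (nhdsWithin_le_nhds (s := Ioi 0))
  simp only [zero_smul, add_zero] at h0
  obtain ⟨t, ht, ht0⟩ := ((h0.eventually (mem_interior_iff_mem_nhds.1 h_int)).and
    self_mem_nhdsWithin).exists
  have ht0 : 0 < t := ht0
  have hpn : perp n (-n) = 0 := by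
    rw [perp_apply, inner_neg_right, real_inner_self_eq_norm_sq, hn]; simp
  have := ht.1
  rw [height_add_smul, profile_add_smul, hx.1, hpn, inner_neg_right, real_inner_self_eq_norm_sq,
    hn] at this
  simp at this
  linarith

theorem frontier_lens_subset (hη : 0 ≤ η) : frontier (lens n p δ η) ⊆
    lensBottom n p δ ∪ {x | height n p x = η * profile n p δ x ∧ 0 ≤ profile n p δ x} := by
  intro x hx
  rw [isClosed_lens.frontier_eq] at hx
  have h0 := profile_nonneg_of_mem_lens hη hx.1
  obtain ⟨⟨h1, h2⟩, h3⟩ := hx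
  by_cases ht : height n p x = η * profile n p δ x
  · exact Or.inr ⟨ht, h0⟩
  have hb : height n p x = -profile n p δ x := by
    by_contra hb
    exact h3 (mem_interior_lens (lt_of_le_of_ne h1 (Ne.symm hb)) (lt_of_le_of_ne h2 ht))
  refine Or.inl ⟨hb, lt_of_le_of_ne h0 fun h => ht ?_⟩
  rw [hb, ← h]; simp

theorem lens_zero_subset (hη : 0 ≤ η) : lens n p δ 0 ⊆ lens n p δ η := fun x hx => by
  have h0 := profile_nonneg_of_mem_lens le_rfl hx
  refine ⟨hx.1, hx.2.trans ?_⟩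
  rw [zero_mul]; positivity

/-- Near a bottom point the height is negative, so the upper constraint plays no role. The lenses
thus have the same normals along the bottom, whose contributions to the perimeters agree. -/
theorem eventually_mem_lens_iff (hη : 0 ≤ η) (hx : x ∈ lensBottom n p δ) :
    ∀ᶠ y in 𝓝 x, y ∈ lens n p δ 0 ↔ y ∈ lens n p δ η := by
  have h1 : height n p x < 0 := by rw [hx.1]; linarith [hx.2]
  filter_upwards [(continuous_height.tendsto x).eventually_lt_const h1] with y hy1
  refine ⟨fun h => lens_zero_subset hη h, fun h => ⟨h.1, ?_⟩⟩
  rw [zero_mul]; exact hy1.le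

section GraphMap

theorem height_graphMap (hn : ‖n‖ = 1) (z : (ℝ ∙ n)ᗮ) :
    height n p (graphMap n p δ η z) = η * ((δ ^ 2 - ‖z‖ ^ 2) / 2) := by
  unfold height graphMap
  rw [add_assoc, add_sub_cancel_left, inner_add_right, inner_smul_right,
    real_inner_self_eq_norm_sq, hn, Submodule.mem_orthogonal_singleton_iff_inner_right.1 z.2]
  ring

theorem perp_graphMap (hn : ‖n‖ = 1) (z : (ℝ ∙ n)ᗮ) : perp n (graphMap n p δ η z - p) = z := by
  have hpn : perp n n = 0 := by
    rw [perp_apply, real_inner_self_eq_norm_sq, hn]; simp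
  unfold graphMap
  rw [add_assoc, add_sub_cancel_left, map_add, map_smul, hpn, perp_coe_orthogonal]; simp

theorem profile_graphMap (hn : ‖n‖ = 1) (z : (ℝ ∙ n)ᗮ) :
    profile n p δ (graphMap n p δ η z) = (δ ^ 2 - ‖z‖ ^ 2) / 2 := by
  unfold profile
  rw [perp_graphMap hn]; rfl

theorem mem_graphMap_image (hn : ‖n‖ = 1) (hδ : 0 ≤ δ)
    (hx : height n p x = η * profile n p δ x) (h0 : 0 ≤ profile n p δ x) :
    x ∈ graphMap n p δ η '' Metric.closedBall 0 δ := by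
  refine ⟨⟨perp n (x - p), ?_⟩, ?_, ?_⟩
  · exact Submodule.mem_orthogonal_singleton_iff_inner_right.2 (inner_perp hn _)
  · rw [mem_closedBall_zero_iff]
    change ‖perp n (x - p)‖ ≤ δ
    unfold profile at h0
    exact abs_le_of_sq_le_sq' (by linarith) hδ |>.2
  · change p + perp n (x - p) + (η * profile n p δ x) • n = x
    rw [← hx, add_assoc]
    unfold height
    rw [perp_add_smul]; abel

theorem graphMap_mem_lensTop (hn : ‖n‖ = 1) {z : (ℝ ∙ n)ᗮ} (hz : z ∈ Metric.ball 0 δ) :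
    graphMap n p δ η z ∈ lensTop n p δ η := by
  refine ⟨by rw [height_graphMap hn, profile_graphMap hn], ?_⟩
  rw [profile_graphMap hn]
  rw [mem_ball_zero_iff] at hz
  nlinarith [norm_nonneg z]

/-- Pythagoras, with slope at most `|η| δ` in the direction `n`. What matters is that the constant
is `1 + O(η²)`. -/
theorem lipschitzOnWith_graphMap (hn : ‖n‖ = 1) :
    LipschitzOnWith (Real.toNNReal √(1 + (η * δ) ^ 2)) (graphMap n p δ η)
      (Metric.closedBall 0 δ) := by
  refine LipschitzOnWith.of_dist_le_mul fun z hz w hw => ?_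
  rw [Real.coe_toNNReal _ (Real.sqrt_nonneg _), dist_eq_norm, dist_eq_norm]
  rw [mem_closedBall_zero_iff] at hz hw
  have hd : graphMap n p δ η z - graphMap n p δ η w =
      ((z - w : (ℝ ∙ n)ᗮ) : E) + (η * ((‖w‖ ^ 2 - ‖z‖ ^ 2) / 2)) • n := by
    unfold graphMap
    have : (η * ((‖w‖ ^ 2 - ‖z‖ ^ 2) / 2)) = η * ((δ ^ 2 - ‖z‖ ^ 2) / 2) -
      η * ((δ ^ 2 - ‖w‖ ^ 2) / 2) := by ring
    rw [this, sub_smul, Submodule.coe_sub]; abel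
  have hsq : ‖graphMap n p δ η z - graphMap n p δ η w‖ ^ 2 =
      ‖z - w‖ ^ 2 + (η * ((‖w‖ ^ 2 - ‖z‖ ^ 2) / 2)) ^ 2 := by
    rw [hd, norm_add_sq_real, inner_smul_right, real_inner_comm,
      Submodule.mem_orthogonal_singleton_iff_inner_right.1 (z - w).2, norm_smul, hn,
      Real.norm_eq_abs, mul_one, sq_abs]
    simp
  have hdiff : ((‖w‖ ^ 2 - ‖z‖ ^ 2) / 2) ^ 2 ≤ (δ * ‖z - w‖) ^ 2 := by
    have h1 : |‖w‖ - ‖z‖| ≤ ‖z - w‖ := by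
      rw [norm_sub_rev]; exact abs_norm_sub_norm_le w z
    have h2 : (‖w‖ - ‖z‖) ^ 2 ≤ ‖z - w‖ ^ 2 := sq_le_sq.2 (by rwa [abs_norm])
    have h3 : ((‖w‖ + ‖z‖) / 2) ^ 2 ≤ δ ^ 2 := by
      apply pow_le_pow_left₀ (by positivity); linarith
    calc ((‖w‖ ^ 2 - ‖z‖ ^ 2) / 2) ^ 2 = ((‖w‖ + ‖z‖) / 2) ^ 2 * (‖w‖ - ‖z‖) ^ 2 := by ring
      _ ≤ δ ^ 2 * ‖z - w‖ ^ 2 := by gcongr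
      _ = _ := by ring
  apply le_of_sq_le_sq ?_ (by positivity)
  rw [mul_pow, Real.sq_sqrt (by positivity), hsq]
  nlinarith [mul_le_mul_of_nonneg_left hdiff (sq_nonneg η)]

end GraphMap

end Lens

theorem isConvexBody_lens {N : ℕ} {n p : EuclideanSpace ℝ (Fin N)} {δ η : ℝ} (hn : ‖n‖ = 1)
    (hδ : 0 < δ) (hη : 0 ≤ η) : IsConvexBody (lens n p δ η) :=
  ⟨isCompact_lens hn hη, convex_lens hη, interior_lens_nonempty hn hδ hη⟩

theorem innerUnitNormal_lens {N : ℕ} {n p x : EuclideanSpace ℝ (Fin N)} {δ η : ℝ} (hn : ‖n‖ = 1)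
    (hη : 0 ≤ η) (hx : x ∈ lensTop n p δ η) :
    innerUnitNormal (lens n p δ η) x =
      -(‖n + η • perp n (x - p)‖⁻¹ • (n + η • perp n (x - p))) := by
  apply innerUnitNormal_eq
  · intro h
    have := one_le_norm_add_smul_perp (η := η) hn (x - p)
    rw [h, norm_zero] at this
    linarith
  · exact fun y hy => inner_sub_nonpos_of_mem_lens hn hη hx hy
  · exact fun v hv => exists_add_smul_mem_lens hn hη hx hv

/-! ### Perimeter bounds for lenses -/

section Perimeter

theorem ae_restrict_closedBall_mem_ball {V : Type*} [NormedAddCommGroup V] [NormedSpace ℝ V]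
    [FiniteDimensional ℝ V] [MeasurableSpace V] [BorelSpace V] (μ : Measure V)
    [μ.IsAddHaarMeasure] {δ : ℝ} (hδ : δ ≠ 0) :
    ∀ᵐ z ∂(μ.restrict (Metric.closedBall (0 : V) δ)), z ∈ Metric.ball (0 : V) δ := by
  rw [ae_restrict_iff' Metric.isClosed_closedBall.measurableSet]
  have h : ∀ᵐ z ∂μ, z ∉ Metric.sphere (0 : V) δ :=
    measure_eq_zero_iff_ae_notMem.1 (Measure.addHaar_sphere_of_ne_zero μ 0 hδ)
  filter_upwards [h] with z hz hz'
  rw [← Metric.ball_union_sphere] at hz'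
  exact hz'.resolve_right hz

variable {N : ℕ} {n p : EuclideanSpace ℝ (Fin N)} {δ η : ℝ}

theorem euclideanHausdorffMeasure_orthogonal (hn : ‖n‖ = 1) :
    (μHE[N - 1] : Measure (ℝ ∙ n)ᗮ) = volume := by
  have hne : n ≠ 0 := by rintro rfl; simp at hn
  have h1 := (ℝ ∙ n).finrank_add_finrank_orthogonal
  rw [finrank_span_singleton hne, finrank_euclideanSpace_fin] at h1
  have h2 : Module.finrank ℝ (ℝ ∙ n)ᗮ = N - 1 := by omega
  rw [← h2]
  exact InnerProductSpace.euclideanHausdorffMeasure_eq_volume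

/-- For `η = 0` the parametrization is an isometry, so the flat top is computed exactly; this
supplies the lower bound that Lipschitz estimates cannot give. -/
theorem setLIntegral_graphMap_zero (hn : ‖n‖ = 1) (F : EuclideanSpace ℝ (Fin N) → ℝ≥0∞)
    (s : Set (ℝ ∙ n)ᗮ) :
    ∫⁻ x in graphMap n p δ 0 '' s, F x ∂μHE[N - 1] = ∫⁻ z in s, F (graphMap n p δ 0 z) := by
  have hiso : Isometry (graphMap n p δ 0) := by
    refine Isometry.of_dist_eq fun z w => ?_
    simp only [graphMap, zero_mul, zero_smul, add_zero, dist_add_left]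
    rfl
  have hemb : MeasurableEmbedding (graphMap n p δ 0) := hiso.isClosedEmbedding.measurableEmbedding
  have h1 : (μHE[N - 1] : Measure (EuclideanSpace ℝ (Fin N))).restrict (graphMap n p δ 0 '' s) =
      Measure.map (graphMap n p δ 0) (volume.restrict s) := by
    rw [← euclideanHausdorffMeasure_orthogonal hn, ← hiso.injective.preimage_image s,
      ← hemb.restrict_map, hiso.injective.preimage_image, hiso.map_euclideanHausdorffMeasure,
      Measure.restrict_restrict_of_subset (image_subset_range _ _)]
  rw [h1, hemb.lintegral_map]

variable {g Φ : EuclideanSpace ℝ (Fin N) → ℝ≥0∞}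
  {f : EuclideanSpace ℝ (Fin N) × EuclideanSpace ℝ (Fin N) → ℝ≥0∞}

/-- The contribution of the lower part of the boundary to the perimeter of a lens. -/
noncomputable def bottomPerimeter (f : EuclideanSpace ℝ (Fin N) × EuclideanSpace ℝ (Fin N) → ℝ≥0∞)
    (n p : EuclideanSpace ℝ (Fin N)) (δ : ℝ) : ℝ≥0∞ :=
  ∫⁻ x in lensBottom n p δ, f (x, innerUnitNormal (lens n p δ 0) x) ∂μHE[N - 1]

theorem measurableSet_lensBottom : MeasurableSet (lensBottom n p δ) :=
  (measurableSet_eq_fun continuous_height.measurable continuous_profile.neg.measurable).inter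
    (measurableSet_lt measurable_const continuous_profile.measurable)

theorem measurableSet_lensTop : MeasurableSet (lensTop n p δ η) :=
  (measurableSet_eq_fun continuous_height.measurable
    (continuous_const.mul continuous_profile).measurable).inter
    (measurableSet_lt measurable_const continuous_profile.measurable)

theorem lensBottom_subset_image (hn : ‖n‖ = 1) (hδ : 0 ≤ δ) :
    lensBottom n p δ ⊆ graphMap n p δ (-1) '' Metric.closedBall 0 δ := fun x hx =>
  mem_graphMap_image hn hδ (by rw [hx.1]; ring) hx.2.le

/-- Serves only to show that the bottom term is finite and can be cancelled. The bottom is part of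
the graph with `η = -1`. -/
theorem bottomPerimeter_le (hn : ‖n‖ = 1) (hδ : 0 ≤ δ) (hfac : ∀ x v, f (x, v) = g x * Φ v)
    {M : ℝ≥0∞} (hM : ∀ v, ‖v‖ ≤ 1 → Φ v ≤ M) :
    bottomPerimeter f n p δ ≤ ((Real.toNNReal √(1 + (-1 * δ) ^ 2) : ℝ≥0) : ℝ≥0∞) ^ (N - 1) *
      ∫⁻ z in Metric.closedBall (0 : (ℝ ∙ n)ᗮ) δ, g (graphMap n p δ (-1) z) * M := by
  calc bottomPerimeter f n p δ
      ≤ ∫⁻ x in lensBottom n p δ, g x * M ∂μHE[N - 1] := by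
        refine lintegral_mono fun x => ?_
        rw [hfac]
        gcongr
        exact hM _ norm_innerUnitNormal_le
    _ ≤ ∫⁻ x in graphMap n p δ (-1) '' Metric.closedBall 0 δ, g x * M ∂μHE[N - 1] :=
        lintegral_mono_set (lensBottom_subset_image hn hδ)
    _ ≤ _ := by
        have := setLIntegral_image_le_of_lipschitzOnWith
          (lipschitzOnWith_graphMap (n := n) (p := p) (δ := δ) (η := -1) hn)
          continuous_graphMap.measurable (N - 1) fun x => g x * M
        rwa [euclideanHausdorffMeasure_orthogonal hn] at this

theorem le_anisotropicPerimeter_lens_zero (hn : ‖n‖ = 1) (hfac : ∀ x v, f (x, v) = g x * Φ v) :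
    bottomPerimeter f n p δ +
      ∫⁻ z in Metric.ball (0 : (ℝ ∙ n)ᗮ) δ, g (graphMap n p δ 0 z) * Φ (-n) ≤
      anisotropicPerimeter f (lens n p δ 0) := by
  unfold anisotropicPerimeter
  refine le_trans ?_ (lintegral_mono_set (union_subset
    (lensBottom_subset_frontier (n := n) (p := p) (δ := δ) hn le_rfl)
    (lensTop_subset_frontier (n := n) (p := p) (δ := δ) hn le_rfl)))
  rw [lintegral_union measurableSet_lensTop (disjoint_lensBottom_lensTop le_rfl)]
  refine add_le_add le_rfl ?_
  calc ∫⁻ z in Metric.ball (0 : (ℝ ∙ n)ᗮ) δ, g (graphMap n p δ 0 z) * Φ (-n)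
      = ∫⁻ x in graphMap n p δ 0 '' Metric.ball 0 δ, g x * Φ (-n) ∂μHE[N - 1] :=
        (setLIntegral_graphMap_zero hn (fun x => g x * Φ (-n)) _).symm
    _ ≤ ∫⁻ x in lensTop n p δ 0, g x * Φ (-n) ∂μHE[N - 1] := by
        apply lintegral_mono_set
        rintro _ ⟨z, hz, rfl⟩
        exact graphMap_mem_lensTop hn hz
    _ = _ := by
        refine setLIntegral_congr_fun measurableSet_lensTop fun x hx => ?_
        rw [hfac, innerUnitNormal_lens hn le_rfl hx]
        simp [hn]

/-- The normal on the top is `-w / ‖w‖` with `w = n + η z` and `‖w‖ ≥ 1`, so homogeneity bounds its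
`Φ`-value by `Φ (-w)`. The rim, where the normal is not computed, is the image of a null sphere. -/
theorem anisotropicPerimeter_lens_le (hn : ‖n‖ = 1) (hδ : 0 < δ) (hη : 0 ≤ η)
    (hΦ_hom : IsOneHomogeneous Φ) (hfac : ∀ x v, f (x, v) = g x * Φ v) :
    anisotropicPerimeter f (lens n p δ η) ≤ bottomPerimeter f n p δ +
      ((Real.toNNReal √(1 + (η * δ) ^ 2) : ℝ≥0) : ℝ≥0∞) ^ (N - 1) *
      ∫⁻ z in Metric.closedBall (0 : (ℝ ∙ n)ᗮ) δ,
        g (graphMap n p δ η z) * Φ (-(n + η • (z : EuclideanSpace ℝ (Fin N)))) := by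
  unfold anisotropicPerimeter
  have hsub : frontier (lens n p δ η) ⊆
      lensBottom n p δ ∪ graphMap n p δ η '' Metric.closedBall 0 δ := by
    refine (frontier_lens_subset hη).trans (union_subset_union_right _ fun x hx => ?_)
    exact mem_graphMap_image hn hδ.le hx.1 hx.2
  refine (lintegral_mono_set hsub).trans ((lintegral_union_le _ _ _).trans ?_)
  refine add_le_add ?_ ?_
  · unfold bottomPerimeter
    refine le_of_eq (setLIntegral_congr_fun measurableSet_lensBottom fun x hx => ?_)
    rw [innerUnitNormal_congr (convex_lens le_rfl) (convex_lens hη)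
      (lensBottom_subset le_rfl hx) (lensBottom_subset hη hx) (eventually_mem_lens_iff hη hx)]
  · have h := setLIntegral_image_le_of_lipschitzOnWith
      (lipschitzOnWith_graphMap (n := n) (p := p) (δ := δ) (η := η) hn)
      continuous_graphMap.measurable (N - 1)
      fun x => f (x, innerUnitNormal (lens n p δ η) x)
    rw [euclideanHausdorffMeasure_orthogonal hn] at h
    refine h.trans ?_
    refine mul_le_mul_right (lintegral_mono_ae ?_) _
    filter_upwards [ae_restrict_closedBall_mem_ball volume hδ.ne'] with z hz
    rw [hfac, innerUnitNormal_lens hn hη (graphMap_mem_lensTop hn hz), perp_graphMap hn]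
    gcongr
    set w := n + η • (z : EuclideanSpace ℝ (Fin N)) with hw
    have hw1 : 1 ≤ ‖w‖ := by
      have := one_le_norm_add_smul_perp (η := η) hn (z : EuclideanSpace ℝ (Fin N))
      rwa [perp_coe_orthogonal] at this
    have hpos : 0 < ‖w‖₊⁻¹ := inv_pos.2 (lt_of_lt_of_le one_pos (by exact_mod_cast hw1))
    have := hΦ_hom ‖w‖₊⁻¹ (-w) hpos
    rw [← smul_neg]
    simp only [NNReal.coe_inv, coe_nnnorm] at this
    rw [this]
    refine mul_le_of_le_one_left' ?_
    rw [ENNReal.coe_le_one_iff]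
    exact inv_le_one_of_one_le₀ (by exact_mod_cast hw1)

end Perimeter

/-! ### Averaging over translations -/

section Translates

variable {E V : Type*} [NormedAddCommGroup E] [InnerProductSpace ℝ E] [FiniteDimensional ℝ E]
  [MeasurableSpace E] [BorelSpace E] [NormedAddCommGroup V] [InnerProductSpace ℝ V]
  [FiniteDimensional ℝ V] [MeasurableSpace V] [BorelSpace V] {g : E → ℝ≥0∞}

/-- A single hypersurface may be null, so local integrability of `g` says nothing about it.
Integrating also over `p` in a ball and using Tonelli bounds the total by the integral of `g` on a
larger ball times the measure of `D`. -/
theorem ae_setLIntegral_translate_ne_top (hg : Measurable g)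
    (hloc : ∀ K : Set E, IsCompact K → ∫⁻ x in K, g x ≠ ∞) {h : V → E} (hh : Continuous h)
    {D : Set V} (hD : IsCompact D) :
    ∀ᵐ p ∂(volume : Measure E), ∫⁻ z in D, g (p + h z) ≠ ∞ := by
  obtain ⟨R, hR⟩ := (hD.image hh).isBounded.exists_norm_le
  have hmeas : Measurable fun q : E × V => g (q.1 + h q.2) := by fun_prop
  have key : ∀ k : ℕ, ∀ᵐ p ∂(volume : Measure E), p ∈ Metric.closedBall (0 : E) k →
      ∫⁻ z in D, g (p + h z) ≠ ∞ := by
    intro k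
    rw [← ae_restrict_iff' Metric.isClosed_closedBall.measurableSet]
    have hfin : ∫⁻ p in Metric.closedBall (0 : E) k, ∫⁻ z in D, g (p + h z) ≠ ∞ := by
      rw [lintegral_lintegral_swap hmeas.aemeasurable]
      have hle : ∫⁻ z in D, ∫⁻ p in Metric.closedBall (0 : E) k, g (p + h z) ≤
          ∫⁻ z in D, ∫⁻ x in Metric.closedBall (0 : E) (k + R), g x := by
        refine setLIntegral_mono measurable_const fun z hz => ?_
        have hz' := hR _ (mem_image_of_mem h hz)
        rw [← (measurePreserving_add_right volume (h z)).setLIntegral_comp_preimage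
          Metric.isClosed_closedBall.measurableSet hg]
        refine lintegral_mono_set fun p hp => ?_
        rw [mem_closedBall_zero_iff] at hp
        rw [mem_preimage, mem_closedBall_zero_iff]
        exact (norm_add_le _ _).trans (add_le_add hp hz')
      refine ne_top_of_le_ne_top ?_ hle
      rw [setLIntegral_const]
      exact ENNReal.mul_ne_top (hloc _ (isCompact_closedBall _ _)) hD.measure_lt_top.ne
    have hm : Measurable fun p => ∫⁻ z in D, g (p + h z) := hmeas.lintegral_prod_right'
    filter_upwards [ae_lt_top hm hfin] with p hp using hp.ne
  filter_upwards [ae_all_iff.2 key] with p hp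
  obtain ⟨k, hk⟩ := exists_nat_ge ‖p‖
  exact hp k (by simpa using hk)

/-- The convolution of two non-negative functions. -/
noncomputable def lconv (φ g : E → ℝ≥0∞) (x : E) : ℝ≥0∞ := ∫⁻ y, φ y * g (x - y)

theorem lintegral_mul_setLIntegral_translate (hg : Measurable g) {φ : E → ℝ≥0∞}
    (hφ : Measurable φ) {h : V → E} (hh : Continuous h) {k : V → ℝ≥0∞} (hk : Measurable k)
    (D : Set V) (x : E) :
    ∫⁻ y, φ y * ∫⁻ z in D, g (x - y + h z) * k z = ∫⁻ z in D, lconv φ g (x + h z) * k z := by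
  have h1 : ∀ y, φ y * ∫⁻ z in D, g (x - y + h z) * k z =
      ∫⁻ z in D, φ y * (g (x - y + h z) * k z) := fun y =>
    (lintegral_const_mul _ (by fun_prop)).symm
  simp_rw [h1]
  rw [lintegral_lintegral_swap (by fun_prop)]
  refine lintegral_congr fun z => ?_
  unfold lconv
  rw [← lintegral_mul_const _ (by fun_prop)]
  refine lintegral_congr fun y => ?_
  rw [mul_assoc, add_sub_right_comm]

end Translates

theorem graphMap_eq_add {E : Type*} [NormedAddCommGroup E] [InnerProductSpace ℝ E] (n p : E)
    (δ η : ℝ) (z : (ℝ ∙ n)ᗮ) : graphMap n p δ η z = p + graphMap n 0 δ η z := by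
  unfold graphMap; abel

/-- The comparison of the perimeters of two lenses, averaged over translations. -/
theorem lconv_lens_inequality {N : ℕ} {n : EuclideanSpace ℝ (Fin N)} {δ η : ℝ}
    {g Φ φ : EuclideanSpace ℝ (Fin N) → ℝ≥0∞}
    {f : EuclideanSpace ℝ (Fin N) × EuclideanSpace ℝ (Fin N) → ℝ≥0∞}
    (hn : ‖n‖ = 1) (hδ : 0 < δ) (hη : 0 ≤ η) (hg : Measurable g) (hΦ : Measurable Φ)
    (hφ : Measurable φ) (hloc : ∀ K, IsCompact K → ∫⁻ x in K, g x ≠ ∞)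
    (hΦ_hom : IsOneHomogeneous Φ) {M : ℝ≥0} (hM : ∀ v, ‖v‖ ≤ 1 → Φ v ≤ M)
    (hfac : ∀ x v, f (x, v) = g x * Φ v) (hmono : MonotoneOnConvexBodies (anisotropicPerimeter f))
    (x : EuclideanSpace ℝ (Fin N)) :
    ∫⁻ z in Metric.closedBall (0 : (ℝ ∙ n)ᗮ) δ, lconv φ g (x + graphMap n 0 δ 0 z) * Φ (-n) ≤
      ((Real.toNNReal √(1 + (η * δ) ^ 2) : ℝ≥0) : ℝ≥0∞) ^ (N - 1) *
      ∫⁻ z in Metric.closedBall (0 : (ℝ ∙ n)ᗮ) δ, lconv φ g (x + graphMap n 0 δ η z) *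
        Φ (-(n + η • (z : EuclideanSpace ℝ (Fin N)))) := by
  set C : ℝ≥0∞ := ((Real.toNNReal √(1 + (η * δ) ^ 2) : ℝ≥0) : ℝ≥0∞) ^ (N - 1) with hC
  have hCtop : C ≠ ∞ := by rw [hC]; finiteness
  have hae : ∀ᵐ p ∂(volume : Measure (EuclideanSpace ℝ (Fin N))),
      ∫⁻ z in Metric.closedBall (0 : (ℝ ∙ n)ᗮ) δ, g (p + graphMap n 0 δ 0 z) * Φ (-n) ≤
      C * ∫⁻ z in Metric.closedBall (0 : (ℝ ∙ n)ᗮ) δ, g (p + graphMap n 0 δ η z) *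
        Φ (-(n + η • (z : EuclideanSpace ℝ (Fin N)))) := by
    filter_upwards [ae_setLIntegral_translate_ne_top hg hloc
      (continuous_graphMap (n := n) (p := 0) (δ := δ) (η := -1))
      (isCompact_closedBall (0 : (ℝ ∙ n)ᗮ) δ)] with p hp
    -- Cancelling the common bottom in `ℝ≥0∞` requires finiteness, which holds for almost every `p`.
    have hbot : bottomPerimeter f n p δ ≠ ∞ := by
      refine ne_top_of_le_ne_top ?_ (bottomPerimeter_le hn hδ.le hfac hM)
      simp_rw [graphMap_eq_add n p]
      have hc : Continuous (graphMap n (0 : EuclideanSpace ℝ (Fin N)) δ (-1)) :=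
        continuous_graphMap
      rw [lintegral_mul_const _ (by fun_prop)]
      finiteness
    have h1 := le_anisotropicPerimeter_lens_zero (p := p) (δ := δ) hn hfac
    have h2 := anisotropicPerimeter_lens_le (p := p) hn hδ hη hΦ_hom hfac
    have h3 := hmono _ _ (isConvexBody_lens (p := p) hn hδ le_rfl) (isConvexBody_lens hn hδ hη)
      (lens_zero_subset hη)
    have h4 := (ENNReal.add_le_add_iff_left hbot).1 (h1.trans (h3.trans h2))
    simp_rw [graphMap_eq_add n p] at h4
    refine le_trans (le_of_eq ?_) h4
    refine setLIntegral_congr ?_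
    refine Filter.EventuallyLE.antisymm ?_
      (Eventually.of_forall fun z hz => Metric.ball_subset_closedBall hz)
    exact (ae_restrict_iff' Metric.isClosed_closedBall.measurableSet).1
      (ae_restrict_closedBall_mem_ball volume hδ.ne')
  -- Substitute `p = x - y`, so that integrating against `φ y` produces the convolution at `x`.
  have hae' : ∀ᵐ y ∂(volume : Measure (EuclideanSpace ℝ (Fin N))), _ :=
    (Measure.measurePreserving_sub_left volume x).quasiMeasurePreserving.ae hae
  rw [← lintegral_mul_setLIntegral_translate hg hφ continuous_graphMap measurable_const,
    ← lintegral_mul_setLIntegral_translate hg hφ continuous_graphMap (by fun_prop),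
    ← lintegral_const_mul' _ _ hCtop]
  refine lintegral_mono_ae ?_
  filter_upwards [hae'] with y hy
  rw [mul_left_comm]
  gcongr

/-! ### Integration by parts on a disc -/

section ByParts

variable {V : Type*} [NormedAddCommGroup V]

/-- Truncating the norm at `δ` extends the paraboloid by zero to a globally Lipschitz function of
compact support, as Lipschitz integration by parts demands. -/
theorem lipschitzWith_truncated_paraboloid {δ : ℝ} (hδ : 0 ≤ δ) :
    LipschitzWith δ.toNNReal fun z : V => (δ ^ 2 - min ‖z‖ δ ^ 2) / 2 := by
  refine LipschitzWith.of_dist_le_mul fun z w => ?_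
  rw [Real.coe_toNNReal _ hδ, Real.dist_eq, dist_eq_norm]
  have h1 : |min ‖w‖ δ - min ‖z‖ δ| ≤ ‖z - w‖ := by
    refine (abs_min_sub_min_le_max _ _ _ _).trans ?_
    rw [sub_self, abs_zero, max_eq_left (abs_nonneg _), norm_sub_rev]
    exact abs_norm_sub_norm_le w z
  have h2 : (δ ^ 2 - min ‖z‖ δ ^ 2) / 2 - (δ ^ 2 - min ‖w‖ δ ^ 2) / 2 =
      ((min ‖w‖ δ + min ‖z‖ δ) / 2) * (min ‖w‖ δ - min ‖z‖ δ) := by ring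
  have h3 : 0 ≤ min ‖w‖ δ := le_min (norm_nonneg _) hδ
  have h4 : 0 ≤ min ‖z‖ δ := le_min (norm_nonneg _) hδ
  rw [h2, abs_mul, abs_of_nonneg (by positivity)]
  gcongr
  linarith [min_le_right ‖w‖ δ, min_le_right ‖z‖ δ]

variable [InnerProductSpace ℝ V] [FiniteDimensional ℝ V] [MeasurableSpace V] [BorelSpace V]

theorem setIntegral_mul_inner_eq {H : V → ℝ} {C : ℝ≥0} (hH : LipschitzWith C H)
    (hd : Differentiable ℝ H) {δ : ℝ} (hδ : 0 < δ) (w : V) :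
    ∫ z in Metric.closedBall (0 : V) δ, H z * inner ℝ z w =
      ∫ z in Metric.closedBall (0 : V) δ, fderiv ℝ H z w * ((δ ^ 2 - ‖z‖ ^ 2) / 2) := by
  set u : V → ℝ := fun z => (δ ^ 2 - min ‖z‖ δ ^ 2) / 2 with hu
  have hout : ∀ z ∉ Metric.closedBall (0 : V) δ, u z = 0 := by
    intro z hz
    rw [mem_closedBall_zero_iff, not_le] at hz
    simp [hu, min_eq_right hz.le]
  have hsupp : HasCompactSupport u :=
    HasCompactSupport.intro (isCompact_closedBall (0 : V) δ) hout
  have key := LipschitzWith.integral_lineDeriv_mul_eq (μ := (volume : Measure V)) hH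
    (lipschitzWith_truncated_paraboloid hδ.le) hsupp w
  have hL : ∫ z, lineDeriv ℝ H z w * u z =
      ∫ z in Metric.closedBall (0 : V) δ, fderiv ℝ H z w * ((δ ^ 2 - ‖z‖ ^ 2) / 2) := by
    rw [← setIntegral_eq_integral_of_forall_compl_eq_zero (s := Metric.closedBall (0 : V) δ)
      fun z hz => by rw [hout z hz, mul_zero]]
    refine setIntegral_congr_fun Metric.isClosed_closedBall.measurableSet fun z hz => ?_
    rw [mem_closedBall_zero_iff] at hz
    simp only [hu]
    rw [(hd z).lineDeriv_eq_fderiv, min_eq_left hz]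
  have hR : ∫ z, lineDeriv ℝ u z (-w) * H z =
      ∫ z in Metric.closedBall (0 : V) δ, H z * inner ℝ z w := by
    have hzero : ∀ z ∉ Metric.closedBall (0 : V) δ, lineDeriv ℝ u z (-w) * H z = 0 := by
      intro z hz
      have hev : u =ᶠ[𝓝 z] fun _ => 0 := by
        filter_upwards [Metric.isClosed_closedBall.isOpen_compl.mem_nhds hz] with y hy
          using hout y hy
      rw [hev.lineDeriv_eq]
      simp [lineDeriv]
    rw [← setIntegral_eq_integral_of_forall_compl_eq_zero hzero]
    refine integral_congr_ae ?_
    filter_upwards [ae_restrict_closedBall_mem_ball volume hδ.ne'] with z hz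
    have hev : u =ᶠ[𝓝 z] fun y => (δ ^ 2 - ‖y‖ ^ 2) / 2 := by
      filter_upwards [Metric.isOpen_ball.mem_nhds hz] with y hy
      rw [mem_ball_zero_iff] at hy
      simp only [hu, min_eq_left hy.le]
    have hder : HasFDerivAt (fun y : V => (δ ^ 2 - ‖y‖ ^ 2) / 2) (-(innerSL ℝ z)) z := by
      have h1 := ((hasStrictFDerivAt_norm_sq z).hasFDerivAt.const_sub (δ ^ 2)).const_smul
        (2⁻¹ : ℝ)
      refine (h1.congr_of_eventuallyEq (Eventually.of_forall fun y => ?_)).congr_fderiv ?_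
      · simp only [Pi.smul_apply, smul_eq_mul]; ring
      · ext y; simp
    rw [hev.lineDeriv_eq, hder.differentiableAt.lineDeriv_eq_fderiv, hder.fderiv]
    simp [mul_comm]
  rw [← hL, ← hR, key]

end ByParts

/-! ### Differentiation in the bulging parameter -/

section Variation

variable {E : Type*} [NormedAddCommGroup E] [InnerProductSpace ℝ E] [FiniteDimensional ℝ E]
  [MeasurableSpace E] [BorelSpace E]

/-- Domination comes from Lipschitz bounds in `η`, not from derivatives near `0`, so `Ψ` need be
differentiable only at `-n`. -/
theorem hasDerivAt_lens_integral {Ψ G : E → ℝ} {M C : ℝ≥0} (hΨ : LipschitzWith M Ψ)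
    (hG : LipschitzWith C G) (hGd : Differentiable ℝ G) {n x₀ : E} {δ : ℝ}
    (hn : ‖n‖ = 1) {L : E →L[ℝ] ℝ} (hL : HasFDerivAt Ψ L (-n)) :
    HasDerivAt (fun η : ℝ => ∫ z in Metric.closedBall (0 : (ℝ ∙ n)ᗮ) δ,
        G (x₀ + graphMap n 0 δ η z) * Ψ (-(n + η • (z : E))))
      (∫ z in Metric.closedBall (0 : (ℝ ∙ n)ᗮ) δ,
        (fderiv ℝ G (x₀ + z) n * ((δ ^ 2 - ‖z‖ ^ 2) / 2) * Ψ (-n) - G (x₀ + z) * L z)) 0 := by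
  have hGc := hG.continuous
  have hΨc := hΨ.continuous
  have hcont : ∀ η : ℝ, Continuous fun z : (ℝ ∙ n)ᗮ =>
      G (x₀ + graphMap n 0 δ η z) * Ψ (-(n + η • (z : E))) := by
    intro η
    have := continuous_graphMap (n := n) (p := 0) (δ := δ) (η := η)
    fun_prop
  have hderivG : ∀ z : (ℝ ∙ n)ᗮ, HasDerivAt (fun η : ℝ => G (x₀ + graphMap n 0 δ η z))
      (fderiv ℝ G (x₀ + z) n * ((δ ^ 2 - ‖z‖ ^ 2) / 2)) 0 := by
    intro z
    have h1 : HasDerivAt (fun η : ℝ => x₀ + graphMap n 0 δ η z)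
        (((δ ^ 2 - ‖z‖ ^ 2) / 2) • n) 0 := by
      unfold graphMap
      have h := ((hasDerivAt_id (0 : ℝ)).mul_const ((δ ^ 2 - ‖z‖ ^ 2) / 2)).smul_const n
      simp only [one_mul, id] at h
      exact (h.const_add _).const_add _
    have h2 : HasFDerivAt G (fderiv ℝ G (x₀ + z)) (x₀ + graphMap n 0 δ 0 z) := by
      have : x₀ + graphMap n 0 δ 0 z = x₀ + z := by simp [graphMap]
      rw [this]
      exact (hGd _).hasFDerivAt
    have h3 := h2.comp_hasDerivAt (0 : ℝ) h1
    rw [map_smul, smul_eq_mul, mul_comm] at h3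
    exact h3
  have hderivΨ : ∀ z : (ℝ ∙ n)ᗮ, HasDerivAt (fun η : ℝ => Ψ (-(n + η • (z : E)))) (-L z) 0 := by
    intro z
    have h1 : HasDerivAt (fun η : ℝ => -(n + η • (z : E))) (-(z : E)) 0 := by
      have h := (hasDerivAt_id (0 : ℝ)).smul_const (z : E)
      simp only [one_smul, id] at h
      exact (h.const_add _).neg
    have h2 : HasFDerivAt Ψ L (-(n + (0 : ℝ) • (z : E))) := by simpa using hL
    have h3 := h2.comp_hasDerivAt (0 : ℝ) h1
    rw [map_neg] at h3
    exact h3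
  have hderiv : ∀ z : (ℝ ∙ n)ᗮ, HasDerivAt (fun η : ℝ =>
      G (x₀ + graphMap n 0 δ η z) * Ψ (-(n + η • (z : E))))
      (fderiv ℝ G (x₀ + z) n * ((δ ^ 2 - ‖z‖ ^ 2) / 2) * Ψ (-n) - G (x₀ + z) * L z) 0 := by
    intro z
    have h := (hderivG z).mul (hderivΨ z)
    have h0 : x₀ + graphMap n 0 δ 0 z = x₀ + z := by simp [graphMap]
    simp only [zero_smul, add_zero, h0] at h
    refine h.congr_deriv ?_
    ring
  -- `a` and `b` bound the `G` and `Ψ` factors for `|η| < 1` over the disc; with the factors'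
  -- Lipschitz constants they give one for the product.
  set a : ℝ := |G x₀| + C * (|δ| + δ ^ 2 / 2) with ha
  set b : ℝ := |Ψ (-n)| + M * |δ| with hb
  have hbd : ∀ z ∈ Metric.closedBall (0 : (ℝ ∙ n)ᗮ) δ, LipschitzOnWith
      (Real.nnabs (C * (δ ^ 2 / 2) * b + a * (M * |δ|)))
      (fun η : ℝ => G (x₀ + graphMap n 0 δ η z) * Ψ (-(n + η • (z : E))))
      (Metric.ball 0 1) := by
    intro z hz
    rw [mem_closedBall_zero_iff] at hz
    have hz' : ‖(z : E)‖ ≤ |δ| := hz.trans (le_abs_self δ)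
    have hu0 : |(δ ^ 2 - ‖z‖ ^ 2) / 2| ≤ δ ^ 2 / 2 := by
      have : ‖z‖ ^ 2 ≤ δ ^ 2 := pow_le_pow_left₀ (norm_nonneg _) hz 2
      rw [abs_of_nonneg (by linarith)]
      nlinarith [sq_nonneg ‖z‖]
    refine LipschitzOnWith.of_dist_le_mul fun s hs t ht => ?_
    rw [mem_ball_zero_iff, Real.norm_eq_abs] at hs ht
    rw [Real.coe_nnabs, abs_of_nonneg (by positivity), Real.dist_eq, Real.dist_eq]
    have hGst : |G (x₀ + graphMap n 0 δ s z) - G (x₀ + graphMap n 0 δ t z)| ≤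
        C * (δ ^ 2 / 2) * |s - t| := by
      have h := hG.dist_le_mul (x₀ + graphMap n 0 δ s z) (x₀ + graphMap n 0 δ t z)
      rw [Real.dist_eq, dist_eq_norm] at h
      refine h.trans ?_
      have h2 : x₀ + graphMap n 0 δ s z - (x₀ + graphMap n 0 δ t z) =
          ((s - t) * ((δ ^ 2 - ‖z‖ ^ 2) / 2)) • n := by
        unfold graphMap
        rw [sub_mul, sub_smul]; abel
      rw [h2, norm_smul, hn, mul_one, Real.norm_eq_abs, abs_mul, mul_assoc,
        mul_comm |s - t|]
      gcongr
    have hΨst : |Ψ (-(n + s • (z : E))) - Ψ (-(n + t • (z : E)))| ≤ M * |δ| * |s - t| := by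
      have h := hΨ.dist_le_mul (-(n + s • (z : E))) (-(n + t • (z : E)))
      rw [Real.dist_eq, dist_eq_norm] at h
      refine h.trans ?_
      have h2 : -(n + s • (z : E)) - -(n + t • (z : E)) = -((s - t) • (z : E)) := by
        rw [sub_smul]; abel
      rw [h2, norm_neg, norm_smul, Real.norm_eq_abs, mul_assoc, mul_comm |s - t|]
      gcongr
    have hΨs : |Ψ (-(n + s • (z : E)))| ≤ b := by
      have h := hΨ.dist_le_mul (-(n + s • (z : E))) (-n)
      rw [Real.dist_eq, dist_eq_norm] at h
      have h2 : -(n + s • (z : E)) - -n = -(s • (z : E)) := by abel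
      rw [h2, norm_neg, norm_smul, Real.norm_eq_abs] at h
      have h3 : |s| * ‖(z : E)‖ ≤ |δ| := by
        calc |s| * ‖(z : E)‖ ≤ 1 * |δ| := by gcongr
          _ = |δ| := one_mul _
      have h4 : M * (|s| * ‖(z : E)‖) ≤ M * |δ| := by gcongr
      have h5 := abs_sub_abs_le_abs_sub (Ψ (-(n + s • (z : E)))) (Ψ (-n))
      rw [hb]; linarith
    have hGt : |G (x₀ + graphMap n 0 δ t z)| ≤ a := by
      have h := hG.dist_le_mul (x₀ + graphMap n 0 δ t z) x₀
      rw [Real.dist_eq, dist_eq_norm, add_sub_cancel_left] at h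
      have h3 : ‖graphMap n 0 δ t z‖ ≤ |δ| + δ ^ 2 / 2 := by
        unfold graphMap
        rw [zero_add]
        refine (norm_add_le _ _).trans (add_le_add hz' ?_)
        rw [norm_smul, hn, mul_one, Real.norm_eq_abs, abs_mul]
        calc |t| * |(δ ^ 2 - ‖z‖ ^ 2) / 2| ≤ 1 * (δ ^ 2 / 2) := by gcongr
          _ = _ := one_mul _
      have h4 : C * ‖graphMap n 0 δ t z‖ ≤ C * (|δ| + δ ^ 2 / 2) := by gcongr
      have h5 := abs_sub_abs_le_abs_sub (G (x₀ + graphMap n 0 δ t z)) (G x₀)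
      rw [ha]; linarith
    set A := G (x₀ + graphMap n 0 δ s z)
    set A' := G (x₀ + graphMap n 0 δ t z)
    set P := Ψ (-(n + s • (z : E)))
    set P' := Ψ (-(n + t • (z : E)))
    calc |A * P - A' * P'| = |(A - A') * P + A' * (P - P')| := by congr 1; ring
      _ ≤ |A - A'| * |P| + |A'| * |P - P'| := by
          rw [← abs_mul, ← abs_mul]; exact abs_add_le _ _
      _ ≤ (C * (δ ^ 2 / 2) * |s - t|) * b + a * (M * |δ| * |s - t|) := by gcongr
      _ = _ := by ring
  have hmeas : AEStronglyMeasurable (fun z : (ℝ ∙ n)ᗮ =>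
      fderiv ℝ G (x₀ + z) n * ((δ ^ 2 - ‖z‖ ^ 2) / 2) * Ψ (-n) - G (x₀ + z) * L z)
      (volume.restrict (Metric.closedBall 0 δ)) := by
    have h1 : Measurable fun z : (ℝ ∙ n)ᗮ => fderiv ℝ G (x₀ + z) n :=
      (measurable_fderiv_apply_const ℝ G n).comp (by fun_prop)
    refine (Measurable.sub ?_ ?_).aestronglyMeasurable
    · exact (h1.mul (by fun_prop)).mul_const _
    · fun_prop
  refine (hasDerivAt_integral_of_dominated_loc_of_lip
    (bound := fun _ => C * (δ ^ 2 / 2) * b + a * (M * |δ|))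
    (Metric.ball_mem_nhds (0 : ℝ) one_pos)
    (Eventually.of_forall fun η => (hcont η).aestronglyMeasurable)
    ((hcont 0).continuousOn.integrableOn_compact (isCompact_closedBall _ _))
    hmeas
    ((ae_restrict_iff' Metric.isClosed_closedBall.measurableSet).2 (Eventually.of_forall hbd))
    (integrableOn_const (isCompact_closedBall _ _).measure_lt_top.ne)
    (Eventually.of_forall hderiv)).2

end Variation

/-! ### Vanishing of the gradient of a smooth weight -/

section Gradient

theorem norm_graphMap_le {E : Type*} [NormedAddCommGroup E] [InnerProductSpace ℝ E] {n : E}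
    (hn : ‖n‖ = 1) {δ η : ℝ} (hδ0 : 0 ≤ δ) (hδ : δ ≤ 1) (hη0 : 0 ≤ η) (hη : η ≤ 1)
    {z : (ℝ ∙ n)ᗮ} (hz : z ∈ Metric.closedBall 0 δ) :
    ‖graphMap n 0 δ η z‖ ≤ 2 := by
  rw [mem_closedBall_zero_iff] at hz
  unfold graphMap
  rw [zero_add]
  refine (norm_add_le _ _).trans ?_
  have h1 : ‖(z : E)‖ ≤ 1 := hz.trans hδ
  have h2 : 0 ≤ (δ ^ 2 - ‖z‖ ^ 2) / 2 := by nlinarith [norm_nonneg z]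
  have h3 : (δ ^ 2 - ‖z‖ ^ 2) / 2 ≤ 1 := by nlinarith [norm_nonneg z]
  rw [norm_smul, hn, mul_one, Real.norm_of_nonneg (mul_nonneg hη0 h2)]
  nlinarith

variable {E : Type*} [NormedAddCommGroup E] [InnerProductSpace ℝ E] [FiniteDimensional ℝ E]
  [MeasurableSpace E] [BorelSpace E]

/-- The first variation of the perimeter of a lens, after an integration by parts. -/
theorem lens_first_variation_eq {Ψ G : E → ℝ} (hΨ : IsGauge Ψ) {C : ℝ≥0}
    (hG : LipschitzWith C G) (hG1 : ContDiff ℝ 1 G) {n : E} (x₀ : E) {δ : ℝ} (hδ : 0 < δ)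
    (hn : ‖n‖ = 1) {L : E →L[ℝ] ℝ} (hL : HasFDerivAt Ψ L (-n)) :
    ∫ z in Metric.closedBall (0 : (ℝ ∙ n)ᗮ) δ,
        (fderiv ℝ G (x₀ + z) n * ((δ ^ 2 - ‖z‖ ^ 2) / 2) * Ψ (-n) - G (x₀ + z) * L z) =
      -∫ z in Metric.closedBall (0 : (ℝ ∙ n)ᗮ) δ,
        fderiv ℝ G (x₀ + z) ((InnerProductSpace.toDual ℝ E).symm L) *
          ((δ ^ 2 - ‖z‖ ^ 2) / 2) := by
  set l := (InnerProductSpace.toDual ℝ E).symm L with hl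
  have hGd : Differentiable ℝ G := hG1.differentiable one_ne_zero
  have hGc := hG.continuous
  have hfc : Continuous (fderiv ℝ G) := hG1.continuous_fderiv one_ne_zero
  have hcomp := isCompact_closedBall (0 : (ℝ ∙ n)ᗮ) δ
  let w : (ℝ ∙ n)ᗮ := ⟨perp n l,
    Submodule.mem_orthogonal_singleton_iff_inner_right.2 (inner_perp hn l)⟩
  have hLw : ∀ z : (ℝ ∙ n)ᗮ, L z = inner ℝ z w := by
    intro z
    rw [← InnerProductSpace.toDual_symm_apply (𝕜 := ℝ) (y := L), ← hl, real_inner_comm]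
    change _ = inner ℝ (z : E) (perp n l)
    rw [← perp_coe_orthogonal z, inner_perp_perp hn]
  -- Euler's identity at `-n` fixes the normal component of `l`, so the normal term and the
  -- integrated tangential term form a single derivative along `l`.
  have hln : inner ℝ n l = -Ψ (-n) := by
    rw [real_inner_comm, hl, InnerProductSpace.toDual_symm_apply, ← hΨ.fderiv_apply_self hL,
      map_neg, neg_neg]
  have hHd : ∀ z : (ℝ ∙ n)ᗮ, HasFDerivAt (fun z : (ℝ ∙ n)ᗮ => G (x₀ + z))
      ((fderiv ℝ G (x₀ + z)).comp (ℝ ∙ n)ᗮ.subtypeL) z := fun z =>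
    (hGd (x₀ + z)).hasFDerivAt.comp z ((ℝ ∙ n)ᗮ.subtypeL.hasFDerivAt.const_add x₀)
  have hHl : LipschitzWith C fun z : (ℝ ∙ n)ᗮ => G (x₀ + z) := by
    refine LipschitzWith.of_dist_le_mul fun z z' => ?_
    refine (hG.dist_le_mul _ _).trans ?_
    rw [dist_add_left]; rfl
  have hparts := setIntegral_mul_inner_eq hHl (fun z => (hHd z).differentiableAt) hδ w
  have hpt : ∀ z : (ℝ ∙ n)ᗮ, fderiv ℝ G (x₀ + z) l * ((δ ^ 2 - ‖z‖ ^ 2) / 2) =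
      fderiv ℝ G (x₀ + z) (perp n l) * ((δ ^ 2 - ‖z‖ ^ 2) / 2) -
      fderiv ℝ G (x₀ + z) n * ((δ ^ 2 - ‖z‖ ^ 2) / 2) * Ψ (-n) := by
    intro z
    conv_lhs => rw [← perp_add_smul (n := n) l, map_add, map_smul, hln, smul_eq_mul]
    ring
  have hfw : ∀ z : (ℝ ∙ n)ᗮ, fderiv ℝ (fun z : (ℝ ∙ n)ᗮ => G (x₀ + z)) z w =
      fderiv ℝ G (x₀ + z) (perp n l) := by
    intro z
    rw [(hHd z).fderiv]; rfl
  simp_rw [hfw] at hparts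
  simp_rw [hpt, hLw]
  rw [integral_sub, integral_sub, hparts]
  · ring
  · exact (Continuous.continuousOn (by fun_prop)).integrableOn_compact hcomp
  · exact (Continuous.continuousOn (by fun_prop)).integrableOn_compact hcomp
  · exact (Continuous.continuousOn (by fun_prop)).integrableOn_compact hcomp
  · exact (Continuous.continuousOn (by fun_prop)).integrableOn_compact hcomp

/-- The right-hand side dominates its own value at `η = 0`, so its right slope there is nonnegative;
the area factor has value `1` and derivative `0`, leaving only the derivative of the integral. -/
theorem lens_first_variation_nonneg {Ψ G : E → ℝ} {M C : ℝ≥0} (hΨ : LipschitzWith M Ψ)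
    (hG : LipschitzWith C G) (hGd : Differentiable ℝ G) {n x₀ : E} {δ : ℝ}
    (hn : ‖n‖ = 1) {L : E →L[ℝ] ℝ} (hL : HasFDerivAt Ψ L (-n)) (d : ℕ)
    (hineq : ∀ η : ℝ, 0 < η → η ≤ 1 →
      ∫ z in Metric.closedBall (0 : (ℝ ∙ n)ᗮ) δ, G (x₀ + graphMap n 0 δ 0 z) * Ψ (-n) ≤
      √(1 + (η * δ) ^ 2) ^ d * ∫ z in Metric.closedBall (0 : (ℝ ∙ n)ᗮ) δ,
        G (x₀ + graphMap n 0 δ η z) * Ψ (-(n + η • (z : E)))) :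
    0 ≤ ∫ z in Metric.closedBall (0 : (ℝ ∙ n)ᗮ) δ,
        (fderiv ℝ G (x₀ + z) n * ((δ ^ 2 - ‖z‖ ^ 2) / 2) * Ψ (-n) - G (x₀ + z) * L z) := by
  have hI := hasDerivAt_lens_integral (x₀ := x₀) (δ := δ) hΨ hG hGd hn hL
  have hK : HasDerivAt (fun η : ℝ => √(1 + (η * δ) ^ 2) ^ d) 0 0 := by
    have h1 : HasDerivAt (fun η : ℝ => 1 + (η * δ) ^ 2) 0 0 := by
      have := (((hasDerivAt_id (0 : ℝ)).mul_const δ).pow 2).const_add 1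
      simpa using this
    have h2 := (h1.sqrt (by simp)).pow d
    rw [zero_div, mul_zero] at h2
    exact h2
  have hJ := hK.mul hI
  have hlim := hJ.tendsto_slope_zero_right
  simp only [zero_mul, zero_add, ne_eq, OfNat.ofNat_ne_zero, not_false_eq_true, zero_pow, add_zero,
    Real.sqrt_one, one_pow, one_mul] at hlim
  refine ge_of_tendsto hlim ?_
  filter_upwards [Ioc_mem_nhdsGT (zero_lt_one : (0 : ℝ) < 1)] with η hη
  have := hineq η hη.1 hη.2
  simp only [Pi.mul_apply, zero_mul, zero_smul, add_zero, ne_eq, OfNat.ofNat_ne_zero,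
    not_false_eq_true, zero_pow, Real.sqrt_one, one_pow, one_mul, smul_eq_mul]
  exact mul_nonneg (inv_nonneg.2 hη.1.le) (sub_nonneg.2 this)

/-- A positive derivative along `l` at `x₀` would persist on a small disc, where the paraboloid
weight is positive inside, contradicting the sign of the first variation. -/
theorem fderiv_nonpos_of_lens_inequality {Ψ G : E → ℝ} (hΨ : IsGauge Ψ) {C : ℝ≥0}
    (hG : LipschitzWith C G) (hG1 : ContDiff ℝ 1 G) {n x₀ : E}
    (hn : ‖n‖ = 1) {L : E →L[ℝ] ℝ} (hL : HasFDerivAt Ψ L (-n)) (d : ℕ)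
    (hineq : ∀ δ : ℝ, 0 < δ → δ ≤ 1 → ∀ η : ℝ, 0 < η → η ≤ 1 →
      ∫ z in Metric.closedBall (0 : (ℝ ∙ n)ᗮ) δ, G (x₀ + graphMap n 0 δ 0 z) * Ψ (-n) ≤
      √(1 + (η * δ) ^ 2) ^ d * ∫ z in Metric.closedBall (0 : (ℝ ∙ n)ᗮ) δ,
        G (x₀ + graphMap n 0 δ η z) * Ψ (-(n + η • (z : E)))) :
    fderiv ℝ G x₀ ((InnerProductSpace.toDual ℝ E).symm L) ≤ 0 := by
  set l := (InnerProductSpace.toDual ℝ E).symm L with hl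
  have hGd : Differentiable ℝ G := hG1.differentiable one_ne_zero
  have hfc : Continuous (fderiv ℝ G) := hG1.continuous_fderiv one_ne_zero
  obtain ⟨M, hM⟩ := hΨ.exists_bound
  by_contra! hpos
  have hcont : Continuous fun z : (ℝ ∙ n)ᗮ => fderiv ℝ G (x₀ + z) l := by fun_prop
  have hev : ∀ᶠ z : (ℝ ∙ n)ᗮ in 𝓝 0, 0 < fderiv ℝ G (x₀ + z) l := by
    refine (hcont.tendsto 0).eventually_const_lt ?_
    simpa using hpos
  obtain ⟨r, hr, hball⟩ := Metric.eventually_nhds_iff_ball.1 hev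
  set δ : ℝ := min (r / 2) 1 with hδdef
  have hδ : 0 < δ := lt_min (by linarith) one_pos
  have hvar := lens_first_variation_nonneg (hΨ.lipschitzWith hM) hG hGd hn hL d
    (hineq δ hδ (min_le_right _ _))
  rw [lens_first_variation_eq hΨ hG hG1 x₀ hδ hn hL] at hvar
  have hlt : 0 < ∫ z in Metric.closedBall (0 : (ℝ ∙ n)ᗮ) δ,
      fderiv ℝ G (x₀ + z) l * ((δ ^ 2 - ‖z‖ ^ 2) / 2) := by
    have hposball : ∀ z ∈ Metric.closedBall (0 : (ℝ ∙ n)ᗮ) δ, 0 < fderiv ℝ G (x₀ + z) l := by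
      intro z hz
      apply hball
      rw [mem_closedBall_zero_iff] at hz
      rw [mem_ball_zero_iff]
      have : δ ≤ r / 2 := min_le_left _ _
      linarith
    rw [setIntegral_pos_iff_support_of_nonneg_ae]
    · refine lt_of_lt_of_le (Metric.measure_ball_pos volume (0 : (ℝ ∙ n)ᗮ) hδ)
        (measure_mono fun z hz => ⟨?_, Metric.ball_subset_closedBall hz⟩)
      have h1 := hposball z (Metric.ball_subset_closedBall hz)
      rw [mem_ball_zero_iff] at hz
      have h2 : 0 < (δ ^ 2 - ‖z‖ ^ 2) / 2 := by nlinarith [norm_nonneg z]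
      exact (mul_pos h1 h2).ne'
    · refine (ae_restrict_iff' Metric.isClosed_closedBall.measurableSet).2
        (Eventually.of_forall fun z hz => ?_)
      have h1 := hposball z hz
      rw [mem_closedBall_zero_iff] at hz
      have h2 : 0 ≤ (δ ^ 2 - ‖z‖ ^ 2) / 2 := by nlinarith [norm_nonneg z]
      exact mul_nonneg h1.le h2
    · exact (Continuous.continuousOn (by fun_prop)).integrableOn_compact (isCompact_closedBall _ _)
  linarith

theorem fderiv_eq_zero_of_lens_inequality {Ψ G : E → ℝ} (hΨ : IsGauge Ψ) (hG : ContDiff ℝ 1 G)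
    (x₀ : E) (d : ℕ)
    (hineq : ∀ n : E, ‖n‖ = 1 → ∀ δ : ℝ, 0 < δ → ∀ η : ℝ, 0 < η →
      ∫ z in Metric.closedBall (0 : (ℝ ∙ n)ᗮ) δ, G (x₀ + graphMap n 0 δ 0 z) * Ψ (-n) ≤
      √(1 + (η * δ) ^ 2) ^ d * ∫ z in Metric.closedBall (0 : (ℝ ∙ n)ᗮ) δ,
        G (x₀ + graphMap n 0 δ η z) * Ψ (-(n + η • (z : E)))) :
    fderiv ℝ G x₀ = 0 := by
  -- The cut-off makes `G` globally Lipschitz. It equals `1` on the ball of radius `2`, which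
  -- contains every top with `δ, η ≤ 1` by `norm_graphMap_le`.
  let χ : ContDiffBump x₀ := ⟨2, 3, by norm_num, by norm_num⟩
  have hχG : ContDiff ℝ 1 fun x => χ x * G x := χ.contDiff.mul hG
  obtain ⟨C, hC⟩ : ∃ C, LipschitzWith C fun x => χ x * G x :=
    hχG.lipschitzWith_of_hasCompactSupport (χ.hasCompactSupport.mul_right) one_ne_zero
  have hev : (fun x => χ x * G x) =ᶠ[𝓝 x₀] G := by
    filter_upwards [χ.eventuallyEq_one] with x hx
    rw [hx]; simp
  have hgraph : ∀ n : E, ‖n‖ = 1 → ∀ δ : ℝ, 0 < δ → δ ≤ 1 → ∀ η : ℝ, 0 ≤ η → η ≤ 1 →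
      ∀ z ∈ Metric.closedBall (0 : (ℝ ∙ n)ᗮ) δ,
      χ (x₀ + graphMap n 0 δ η z) * G (x₀ + graphMap n 0 δ η z) =
        G (x₀ + graphMap n 0 δ η z) := by
    intro n hn δ hδ0 hδ η hη0 hη z hz
    rw [χ.one_of_mem_closedBall, one_mul]
    rw [mem_closedBall_iff_norm, add_sub_cancel_left]
    exact norm_graphMap_le hn hδ0.le hδ hη0 hη hz
  rw [← hev.fderiv_eq]
  set l := (InnerProductSpace.toDual ℝ E).symm (fderiv ℝ (fun x => χ x * G x) x₀) with hl
  have hl0 : l = 0 := by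
    refine hΨ.eq_zero_of_forall_fderiv_nonpos fun m hm L hL => ?_
    have hL' : HasFDerivAt Ψ L (-(-m)) := by rwa [neg_neg]
    have h := fderiv_nonpos_of_lens_inequality (x₀ := x₀) (n := -m) hΨ hC hχG (by rwa [norm_neg])
      hL' d fun δ hδ0 hδ η hη0 hη => by
        have h := hineq (-m) (by rwa [norm_neg]) δ hδ0 η hη0
        have e1 := setIntegral_congr_fun (μ := volume)
          (Metric.isClosed_closedBall (x := (0 : (ℝ ∙ -m)ᗮ)) (ε := δ)).measurableSet
          (f := fun z => χ (x₀ + graphMap (-m) 0 δ 0 z) * G (x₀ + graphMap (-m) 0 δ 0 z) * Ψ (- -m))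
          (g := fun z => G (x₀ + graphMap (-m) 0 δ 0 z) * Ψ (- -m)) fun z hz => by
            simp only [hgraph (-m) (by rwa [norm_neg]) δ hδ0 hδ 0 le_rfl zero_le_one z hz]
        have e2 := setIntegral_congr_fun (μ := volume)
          (Metric.isClosed_closedBall (x := (0 : (ℝ ∙ -m)ᗮ)) (ε := δ)).measurableSet
          (f := fun z => χ (x₀ + graphMap (-m) 0 δ η z) * G (x₀ + graphMap (-m) 0 δ η z) *
            Ψ (-(-m + η • (z : E))))
          (g := fun z => G (x₀ + graphMap (-m) 0 δ η z) * Ψ (-(-m + η • (z : E)))) fun z hz => by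
            simp only [hgraph (-m) (by rwa [norm_neg]) δ hδ0 hδ η hη0.le hη z hz]
        rw [e1, e2]
        exact h
    rwa [← InnerProductSpace.toDual_symm_apply (𝕜 := ℝ), real_inner_comm,
      InnerProductSpace.toDual_symm_apply] at h
  rw [hl] at hl0
  simpa using hl0

end Gradient

open scoped Convolution

/-! ### Mollified weights and conclusion -/

section Mollification

variable {E : Type*} [NormedAddCommGroup E] [InnerProductSpace ℝ E] [FiniteDimensional ℝ E]
  [MeasurableSpace E] [BorelSpace E] {g : E → ℝ≥0∞}

theorem locallyIntegrable_toReal (hg : Measurable g)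
    (hloc : ∀ K : Set E, IsCompact K → ∫⁻ x in K, g x ≠ ∞) :
    LocallyIntegrable (fun x => (g x).toReal) (volume : Measure E) := by
  rw [locallyIntegrable_iff]
  exact fun K hK => integrable_toReal_of_lintegral_ne_top hg.aemeasurable (hloc K hK)

/-- Infinite values of `g` occupy a null set, so passing to `toReal` does not change the
convolution. -/
theorem lconv_ofReal_eq (hg : Measurable g)
    (hloc : ∀ K : Set E, IsCompact K → ∫⁻ x in K, g x ≠ ∞) {φ : E → ℝ} (hφ : Continuous φ)
    (hφ0 : ∀ x, 0 ≤ φ x) (hφc : HasCompactSupport φ) (x : E) :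
    lconv (fun y => ENNReal.ofReal (φ y)) g x =
      ENNReal.ofReal ((φ ⋆[ContinuousLinearMap.lsmul ℝ ℝ, volume] fun x => (g x).toReal) x) := by
  have h_int : Integrable (fun y => φ y • (g (x - y)).toReal) (volume : Measure E) :=
    hφc.convolutionExists_left (ContinuousLinearMap.lsmul ℝ ℝ) hφ
      (locallyIntegrable_toReal hg hloc) x
  have hconv : (φ ⋆[ContinuousLinearMap.lsmul ℝ ℝ, volume] fun x => (g x).toReal) x =
      ∫ y, φ y • (g (x - y)).toReal := rfl
  rw [hconv, ofReal_integral_eq_lintegral_ofReal h_int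
    (Eventually.of_forall fun y => mul_nonneg (hφ0 y) ENNReal.toReal_nonneg)]
  refine lintegral_congr_ae ?_
  filter_upwards [(Measure.measurePreserving_sub_left volume x).quasiMeasurePreserving.ae
    (ae_ne_top_of_setLIntegral_ne_top hg hloc)] with y hy
  rw [smul_eq_mul, ENNReal.ofReal_mul (hφ0 y), ENNReal.ofReal_toReal hy]

/-- If all mollifications of a locally integrable function are constant, then so is the
function. -/
theorem exists_ae_eq_const_of_convolution {γ : E → ℝ} (hγ : LocallyIntegrable γ volume)
    (hconst : ∀ φ : ContDiffBump (0 : E), ∀ x y,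
      (φ.normed volume ⋆[ContinuousLinearMap.lsmul ℝ ℝ, volume] γ) x =
      (φ.normed volume ⋆[ContinuousLinearMap.lsmul ℝ ℝ, volume] γ) y) :
    ∃ c, ∀ᵐ x ∂(volume : Measure E), γ x = c := by
  -- Outer radius twice the inner one: the fixed ratio lets Lebesgue differentiation apply with `K =
  -- 2`.
  let φ : ℕ → ContDiffBump (0 : E) := fun k =>
    ⟨1 / ((k : ℝ) + 1), 2 * (1 / ((k : ℝ) + 1)), by positivity, by
      have : 0 < 1 / ((k : ℝ) + 1) := by positivity
      linarith⟩
  have hlim : Tendsto (fun k => (φ k).rOut) atTop (𝓝 0) := by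
    have h := (tendsto_one_div_add_atTop_nhds_zero_nat (𝕜 := ℝ)).const_mul 2
    rwa [mul_zero] at h
  have hae := ContDiffBump.ae_convolution_tendsto_right_of_locallyIntegrable
    (φ := φ) (K := 2) hlim (Eventually.of_forall fun k => le_rfl) hγ
  obtain ⟨x₁, hx₁⟩ := hae.exists
  refine ⟨γ x₁, ?_⟩
  filter_upwards [hae] with x hx
  exact tendsto_nhds_unique (hx.congr fun k => hconst (φ k) x x₁) hx₁

end Mollification

theorem setLIntegral_ofReal_mul {V : Type*} [TopologicalSpace V] [T2Space V] [MeasurableSpace V]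
    [BorelSpace V] {μ : Measure V} [IsFiniteMeasureOnCompacts μ] {D : Set V} (hD : IsCompact D)
    {a b : V → ℝ} (ha : Continuous a) (hb : Continuous b) (ha0 : ∀ z, 0 ≤ a z)
    (hb0 : ∀ z, 0 ≤ b z) :
    ∫⁻ z in D, ENNReal.ofReal (a z) * ENNReal.ofReal (b z) ∂μ =
      ENNReal.ofReal (∫ z in D, a z * b z ∂μ) := by
  have h_int : IntegrableOn (fun z => a z * b z) D μ :=
    (ha.mul hb).continuousOn.integrableOn_compact hD
  rw [ofReal_integral_eq_lintegral_ofReal h_int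
    (Eventually.of_forall fun z => mul_nonneg (ha0 z) (hb0 z))]
  exact lintegral_congr fun z => (ENNReal.ofReal_mul (ha0 z)).symm

theorem convolution_const_of_monotone {N : ℕ}
    {f : EuclideanSpace ℝ (Fin N) × EuclideanSpace ℝ (Fin N) → ℝ≥0∞}
    {g Φ : EuclideanSpace ℝ (Fin N) → ℝ≥0∞} (hg : Measurable g) (hΦ : Measurable Φ)
    (hloc : ∀ K, IsCompact K → ∫⁻ x in K, g x ≠ ∞) (hΦ_hom : IsOneHomogeneous Φ)
    (hΦ_fin : ∀ v, Φ v ≠ ∞) (hgauge : IsGauge fun v => (Φ v).toReal)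
    (hfac : ∀ x v, f (x, v) = g x * Φ v) (hmono : MonotoneOnConvexBodies (anisotropicPerimeter f))
    (φ : ContDiffBump (0 : EuclideanSpace ℝ (Fin N))) (x y : EuclideanSpace ℝ (Fin N)) :
    (φ.normed volume ⋆[ContinuousLinearMap.lsmul ℝ ℝ, volume] fun x => (g x).toReal) x =
      (φ.normed volume ⋆[ContinuousLinearMap.lsmul ℝ ℝ, volume] fun x => (g x).toReal) y := by
  set G := φ.normed volume ⋆[ContinuousLinearMap.lsmul ℝ ℝ, volume] fun x => (g x).toReal with hGdef
  have hφc : HasCompactSupport (φ.normed volume) := φ.hasCompactSupport_normed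
  have hφcont : Continuous (φ.normed volume) := φ.continuous_normed
  have hφ0 : ∀ x, 0 ≤ φ.normed volume x := φ.nonneg_normed
  have hG1 : ContDiff ℝ 1 G :=
    hφc.contDiff_convolution_left _ φ.contDiff_normed (locallyIntegrable_toReal hg hloc)
  have hGc : Continuous G := hG1.continuous
  have hG0 : ∀ x, 0 ≤ G x := fun x =>
    integral_nonneg fun y => mul_nonneg (hφ0 y) ENNReal.toReal_nonneg
  obtain ⟨M, hM⟩ := hgauge.exists_bound
  have hΨc : Continuous fun v => (Φ v).toReal := (hgauge.lipschitzWith hM).continuous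
  have hΦr : ∀ v, Φ v = ENNReal.ofReal (Φ v).toReal := fun v =>
    (ENNReal.ofReal_toReal (hΦ_fin v)).symm
  have hΦM : ∀ v, ‖v‖ ≤ 1 → Φ v ≤ M := by
    intro v hv
    rw [hΦr v, ← ENNReal.ofReal_coe_nnreal]
    refine ENNReal.ofReal_le_ofReal ((hM v).trans ?_)
    exact mul_le_of_le_one_right M.2 hv
  refine is_const_of_fderiv_eq_zero (𝕜 := ℝ) (hG1.differentiable one_ne_zero) (fun x₀ => ?_) x y
  refine fderiv_eq_zero_of_lens_inequality hgauge hG1 x₀ (N - 1) fun n hn δ hδ η hη => ?_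
  have h := lconv_lens_inequality (n := n) (δ := δ) (η := η) hn hδ hη.le hg hΦ
    (φ := fun y => ENNReal.ofReal (φ.normed volume y)) (by fun_prop) hloc hΦ_hom hΦM hfac hmono x₀
  simp_rw [lconv_ofReal_eq hg hloc hφcont hφ0 hφc, ← hGdef] at h
  have hgm : ∀ t : ℝ, Continuous (graphMap n 0 δ t) := fun t => continuous_graphMap
  have e : ∀ t : ℝ, ∫⁻ z in Metric.closedBall (0 : (ℝ ∙ n)ᗮ) δ,
      ENNReal.ofReal (G (x₀ + graphMap n 0 δ t z)) *
        Φ (-(n + t • (z : EuclideanSpace ℝ (Fin N)))) =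
      ENNReal.ofReal (∫ z in Metric.closedBall (0 : (ℝ ∙ n)ᗮ) δ, G (x₀ + graphMap n 0 δ t z) *
        (Φ (-(n + t • (z : EuclideanSpace ℝ (Fin N))))).toReal) := by
    intro t
    rw [← setLIntegral_ofReal_mul (isCompact_closedBall _ _)
      (a := fun z => G (x₀ + graphMap n 0 δ t z))
      (b := fun z => (Φ (-(n + t • (z : EuclideanSpace ℝ (Fin N))))).toReal)
      (hGc.comp (continuous_const.add (hgm t))) (hΨc.comp (by fun_prop)) (fun _ => hG0 _)
      fun _ => ENNReal.toReal_nonneg]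
    exact lintegral_congr fun z => by rw [← hΦr]
  have e0 := e 0
  simp only [zero_smul, add_zero] at e0
  rw [e0, e η, ← ENNReal.ofReal, ← ENNReal.ofReal_pow (Real.sqrt_nonneg _),
    ← ENNReal.ofReal_mul (by positivity), ENNReal.ofReal_le_ofReal_iff] at h
  · exact h
  · exact mul_nonneg (by positivity)
      (integral_nonneg fun z => mul_nonneg (hG0 _) ENNReal.toReal_nonneg)

end WeightedPerimeter

theorem corollary1p2 (N : ℕ) (hN : 2 ≤ N)
    (f : EuclideanSpace ℝ (Fin N) × EuclideanSpace ℝ (Fin N) → ℝ≥0∞)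
    (hf : Measurable f) (hf_loc : LocallyIntegrable f volume)
    (g : EuclideanSpace ℝ (Fin N) → ℝ≥0∞)
    (hg : Measurable g) (hg_radial : WeightedPerimeter.IsRadial g)
    (Φ : EuclideanSpace ℝ (Fin N) → ℝ≥0∞)
    (hΦ_lsc : LowerSemicontinuous Φ)
    (hΦ_hom : WeightedPerimeter.IsOneHomogeneous Φ)
    (hΦ_convex : ConvexOn ℝ≥0 univ Φ)
    (hΦ_pos : ∀ v, v ≠ 0 → 0 < Φ v)
    (hfac : ∀ x v, f (x, v) = g x * Φ v)
    (hmono : WeightedPerimeter.MonotoneOnConvexBodies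
      (WeightedPerimeter.anisotropicPerimeter f)) :
    ∃ c : ℝ≥0, ∀ᵐ x ∂(volume : Measure (EuclideanSpace ℝ (Fin N))), g x = c := by
  open WeightedPerimeter in
  -- Treated apart because a null weight puts no finiteness constraint on `Φ`.
  by_cases hg0 : ∀ᵐ x ∂(volume : Measure (EuclideanSpace ℝ (Fin N))), g x = 0
  · exact ⟨0, by simpa using hg0⟩
  have : Nontrivial (EuclideanSpace ℝ (Fin N)) :=
    Module.nontrivial_of_finrank_pos (R := ℝ) (by rw [finrank_euclideanSpace_fin]; omega)
  have hΦ : Measurable Φ := hΦ_lsc.measurable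
  have hloc : ∀ K, IsCompact K → ∫⁻ x in K, g x ≠ ∞ := fun K hK =>
    setLIntegral_ne_top_of_mul hf_loc hg hΦ hΦ_pos hfac hK
  have hfin : ∀ v, Φ v ≠ ∞ :=
    ne_top_of_convexOn_of_ae hΦ_convex (ae_ne_top_of_mul hf_loc hg hΦ hfac hg0)
  obtain ⟨c, hc⟩ := exists_ae_eq_const_of_convolution (locallyIntegrable_toReal hg hloc)
    (convolution_const_of_monotone hg hΦ hloc hΦ_hom hfin
      (isGauge_toReal hΦ_hom hΦ_convex hΦ_pos hfin) hfac hmono)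
  refine ⟨c.toNNReal, ?_⟩
  filter_upwards [hc, ae_ne_top_of_setLIntegral_ne_top hg hloc] with x hx hx'
  rw [← ENNReal.ofReal_toReal hx', hx]
  rfl
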